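/- Let $\mathfrak S_n$ be the symmetric group of degree $n$; for $l\le n$, $\mathfrak S_l\subset\mathfrak S_n$ permutes the first $l$ indices and fixes the others. For a Young diagram $\lambda$ with $n$ cells let $\pi_\lambda$ be the corresponding irreducible complex representation of $\mathfrak S_n$ (with $\pi_{(n)}$ trivial). Let $A_{n,m}=\{\sum_{|I|=m}c_Ix_I\}$, where $x_I=\prod_{i\in I}x_i$, $I\subset\{1,\dots,n\}$, be the space of square-free homogeneous forms of degree $m$ in $n$ variables with complex coefficients, with the action $\sigma x_I=x_{\sigma I}$ of $\mathfrak S_n$ and the norm $\|\sum c_Ix_I\|^2=\sum|c_I|^2$. Let $k\le m\le n-k$ (so that $2k\le n$), and let $H_{n,m}^k\subset A_{n,m}$ be the isotypic component of type $\pi_{(n-k,k)}$. For a standard Young tableau $u$ of shape $(n-k,k)$ let $\lambda_l(u)$ be the diagram formed by the cells of $u$ with entries $1,\dots,l$, and let $V_u\subset H_{n,m}^k$ be the subspace of those vectors of $H_{n,m}^k$ that, for every $l<n$, lie in the isotypic component of type $\pi_{\lambda_l(u)}$ of $A_{n,m}$ with respect to $\mathfrak S_l$. A Gelfand–Tsetlin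 basis in $H_{n,m}^k$ is a basis $\{h_u\}$ of $H_{n,m}^k$, indexed by the standard tableaux $u$ of shape $(n-k,k)$, with $h_u\in V_u$ and $\|h_u\|=1$. **Theorem.** For a standard tableau $u$ of shape $(n-k,k)$ with second row $p_1<p_2<\dots<p_k$ put $$F_u=\sum (x_{i_1}-x_{p_1})\cdots(x_{i_k}-x_{p_k})\,x_{s_1}\cdots x_{s_{m-k}},$$ where the sum runs over all indices $i_1,\dots,i_k,s_1,\dots,s_{m-k}\in\{1,\dots,n\}$ such that $i_j<p_j$ for all $j=1,\dots,k$ and all the indices $i_1,\dots,i_k,p_1,\dots,p_k,s_1,\dots,s_{m-k}$ are pairwise distinct. Then $F_u\neq0$ and $V_u=\mathbb C F_u$ for every such $u$. A family $\{h_u\}$ of vectors of $A_{n,m}$ indexed by these tableaux is a Gelfand–Tsetlin basis in $H_{n,m}^k$ if and only if for every $u$ one has $h_u=c_uF_u$ with a normalizing constant $c_u\in\mathbb C$, $|c_u|=1/\|F_u\|$. -/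

import Mathlib

namespace TwoRowTensor

noncomputable section

/-- The action of `𝔖ₙ` on polynomials in `n` variables by `σ · x_i = x_{σ i}`. -/
def polyRep (n : ℕ) :
    Representation ℂ (Equiv.Perm (Fin n)) (MvPolynomial (Fin n) ℂ) where
  toFun σ := (MvPolynomial.rename σ).toLinearMap
  map_one' := LinearMap.ext fun f => by simp
  map_mul' σ τ := LinearMap.ext fun f => by simp [MvPolynomial.rename_rename]

/-! ### The irreducible representations `π_μ` of the symmetric groups -/

/-- The Specht polynomial of a filling `t` of the diagram `μ`: the product of
`x_{t(i,j)} - x_{t(i',j)}` over all pairs of cells `(i,j)`, `(i',j)`, `i < i'`, of one column,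
that is, the product of the Vandermonde determinants of the columns (up to sign). -/
def spechtPolynomial {μ : YoungDiagram} {n : ℕ} (t : μ.cells ≃ Fin n) :
    MvPolynomial (Fin n) ℂ :=
  ∏ c : μ.cells, ∏ d : μ.cells,
    if c.1.2 = d.1.2 ∧ c.1.1 < d.1.1 then
      MvPolynomial.X (t c) - MvPolynomial.X (t d)
    else 1

/-- The Specht module of a diagram `μ` with `n` cells, the irreducible representation `π_μ` of
`𝔖ₙ`, realized (after Specht) as the span of the Specht polynomials of all fillings of `μ`.
With this convention the one-row diagram gives the trivial representation. -/
def spechtModule (n : ℕ) (μ : YoungDiagram) : Subrepresentation (polyRep n) where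
  toSubmodule := Submodule.span ℂ (Set.range fun t : μ.cells ≃ Fin n => spechtPolynomial t)
  apply_mem_toSubmodule σ v hv := by
    induction hv using Submodule.span_induction with
    | mem x hx =>
      obtain ⟨t, rfl⟩ := hx
      refine Submodule.subset_span ⟨t.trans σ, ?_⟩
      simp only [spechtPolynomial, polyRep, MonoidHom.coe_mk, OneHom.coe_mk,
        AlgHom.toLinearMap_apply, map_prod]
      refine Finset.prod_congr rfl fun c _ => Finset.prod_congr rfl fun d _ => ?_
      split_ifs <;> simp
    | zero => simp
    | add x y _ _ hx hy => simpa using Submodule.add_mem _ hx hy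
    | smul a x _ hx => simpa using Submodule.smul_mem _ a hx

/-- The representation `π_μ`. -/
abbrev spechtRep (n : ℕ) (μ : YoungDiagram) :
    Representation ℂ (Equiv.Perm (Fin n)) (spechtModule n μ).toSubmodule :=
  (spechtModule n μ).toRepresentation

/-- The isotypic component of type `σ` of a representation `ρ`: the sum of all
subrepresentations of `ρ` that are equivalent to `σ`. -/
def isotypicSubspace {G V W : Type*} [Group G] [AddCommGroup V] [Module ℂ V]
    [AddCommGroup W] [Module ℂ W] (ρ : Representation ℂ G V) (σ : Representation ℂ G W) :
    Submodule ℂ V :=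
  (Subrepresentation.ofSubmodule'
    (isotypicComponent (MonoidAlgebra ℂ G) ρ.asModule σ.asModule)).toSubmodule

/-! ### Young tableaux -/

/-- A (standard) Young tableau of shape `μ` with `n` cells. Numbers are counted from `0`, so the
entries are the elements of `Fin n`. A bijection is monotone for the componentwise order
of the cells exactly when the entries increase along every row and every column. -/
structure Tableau (μ : YoungDiagram) (n : ℕ) where
  entry : μ.cells ≃ Fin n
  monotone_entry : Monotone entry

/-- The diagram formed by the `l` smallest entries of a tableau: the `l`-th vertex of the
corresponding path in the Young graph. -/
def Tableau.diagram {μ : YoungDiagram} {n : ℕ} (u : Tableau μ n) (l : ℕ) : YoungDiagram where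
  cells := (Finset.univ.filter fun c : μ.cells => (u.entry c : ℕ) < l).map
    (Function.Embedding.subtype _)
  isLowerSet := by
    intro a b hba ha
    simp only [Finset.coe_map, Set.mem_image, Finset.mem_coe, Finset.mem_filter,
      Finset.mem_univ, true_and] at ha ⊢
    obtain ⟨c, hc, rfl⟩ := ha
    refine ⟨⟨b, μ.isLowerSet hba c.2⟩, lt_of_le_of_lt ?_ hc, rfl⟩
    exact u.monotone_entry (show b ≤ c.1 from hba)

/-- The two-row diagram `(n - k, k)`, for `k ≤ n / 2`. -/
def twoRow (n k : ℕ) (hk : 2 * k ≤ n) : YoungDiagram :=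
  YoungDiagram.ofRowLens [n - k, k] (by
    simp [List.sortedGE_iff_pairwise]
    omega)

theorem mem_twoRow_second {n k : ℕ} (hk : 2 * k ≤ n) (j : Fin k) :
    ((1, (j : ℕ)) : ℕ × ℕ) ∈ (twoRow n k hk).cells := by
  rw [YoungDiagram.mem_cells, twoRow, YoungDiagram.mem_ofRowLens]
  exact ⟨by simp, by simp⟩

/-- The elements `p_1 < p_2 < ... < p_k` of the second row of a two-row tableau. -/
def Tableau.secondRow {n k : ℕ} {hk : 2 * k ≤ n} (u : Tableau (twoRow n k hk) n)
    (j : Fin k) : Fin n :=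
  u.entry ⟨(1, (j : ℕ)), mem_twoRow_second hk j⟩

/-! ### The tensor model -/

/-- The square-free monomial `x_I`. -/
def monomialOf {n : ℕ} (I : Finset (Fin n)) : MvPolynomial (Fin n) ℂ :=
  ∏ i ∈ I, MvPolynomial.X i

/-- The representation of `𝔖ₙ` in the space `A_{n,m}` of square-free homogeneous forms of degree
`m` in `n` variables. -/
def formSubrep (n m : ℕ) : Subrepresentation (polyRep n) where
  toSubmodule := Submodule.span ℂ
    {f | ∃ I : Finset (Fin n), I.card = m ∧ f = monomialOf I}
  apply_mem_toSubmodule σ v hv := by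
    induction hv using Submodule.span_induction with
    | mem x hx =>
      obtain ⟨I, hI, rfl⟩ := hx
      refine Submodule.subset_span ⟨I.map σ.toEmbedding, by simpa using hI, ?_⟩
      simp [polyRep, monomialOf]
    | zero => simp
    | add x y _ _ hx hy => simpa using Submodule.add_mem _ hx hy
    | smul a x _ hx => simpa using Submodule.smul_mem _ a hx

/-- The space `A_{n,m}`. -/
abbrev Forms (n m : ℕ) : Submodule ℂ (MvPolynomial (Fin n) ℂ) := (formSubrep n m).toSubmodule

/-- The representation of `𝔖ₙ` in `A_{n,m}` by substitutions of indices. -/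
abbrev formRep (n m : ℕ) : Representation ℂ (Equiv.Perm (Fin n)) (Forms n m) :=
  (formSubrep n m).toRepresentation

/-- The norm of a square-free form of degree `m`: `‖∑ c_I x_I‖² = ∑ |c_I|²`. -/
def formNorm {n : ℕ} (m : ℕ) (f : MvPolynomial (Fin n) ℂ) : ℝ :=
  Real.sqrt (∑ I ∈ (Finset.univ : Finset (Fin n)).powersetCard m,
    ‖MvPolynomial.coeff (∑ i ∈ I, Finsupp.single i 1) f‖ ^ 2)

/-- The restriction of the representation in `A_{n,m}` to the subgroup `𝔖_l` of the permutations
of the first `l` indices. -/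
def restrictedRep (n m l : ℕ) (hl : l ≤ n) :
    Representation ℂ (Equiv.Perm (Fin l)) (Forms n m) :=
  (formRep n m).comp (Equiv.Perm.viaEmbeddingHom (Fin.castLEEmb hl))

/-- The subspace `H_{n,m}^k` of `A_{n,m}` corresponding to `π_{(n-k,k)}`. -/
def hSubspace (n m k : ℕ) (hk : 2 * k ≤ n) : Submodule ℂ (Forms n m) :=
  isotypicSubspace (formRep n m) (spechtRep n (twoRow n k hk))

/-- The Gelfand–Tsetlin subspace of `H_{n,m}^k` corresponding to a tableau `u`, that is, to the
path `λ_0 ⊂ λ_1 ⊂ ... ⊂ λ_n` in the Young graph: the vectors of `H_{n,m}^k` that for every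
`l < n` lie in the isotypic component of type `π_{λ_l}` with respect to `𝔖_l`. -/
def gzSubspace {n k : ℕ} {hk : 2 * k ≤ n} (m : ℕ) (u : Tableau (twoRow n k hk) n) :
    Submodule ℂ (Forms n m) :=
  hSubspace n m k hk ⊓
    ⨅ l : Fin n, isotypicSubspace (restrictedRep n m l l.is_lt.le) (spechtRep l (u.diagram l))

/-- A family of vectors indexed by the tableaux of shape `(n-k,k)` is a (normalized)
Gelfand–Tsetlin basis in `H_{n,m}^k` if it is a basis of `H_{n,m}^k` consisting of unit
vectors of the Gelfand–Tsetlin subspaces. -/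
structure IsGelfandTsetlinBasis (n m k : ℕ) (hk : 2 * k ≤ n)
    (h : Tableau (twoRow n k hk) n → Forms n m) : Prop where
  mem : ∀ u, h u ∈ gzSubspace m u
  norm_eq_one : ∀ u, formNorm m (h u : MvPolynomial (Fin n) ℂ) = 1
  linearIndependent : LinearIndependent ℂ h
  span_eq : Submodule.span ℂ (Set.range h) = hSubspace n m k hk

open scoped Classical in
/-- The sum of `(x_{i_1} - x_{p_1}) ⋯ (x_{i_k} - x_{p_k}) x_{s_1} ⋯ x_{s_r}` over all `i_1, …, i_k`,
`s_1, …, s_r` such that `i_j < p_j` for all `j` and all indices `i_1, …, i_k`, `p_1, …, p_k`,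
`s_1, …, s_r` are pairwise distinct. -/
def pseudoMonomialSum {n k : ℕ} (r : ℕ) (p : Fin k → Fin n) : MvPolynomial (Fin n) ℂ :=
  ∑ q : (Fin k → Fin n) × (Fin r → Fin n) with
      (∀ j, q.1 j < p j) ∧ Function.Injective (Sum.elim q.1 (Sum.elim p q.2)),
    (∏ j, (MvPolynomial.X (q.1 j) - MvPolynomial.X (p j))) * ∏ a, MvPolynomial.X (q.2 a)

end

end TwoRowTensor

/-!
The proof identifies every isotypic component that occurs in the statement with an eigenspace and
then compares joint eigenvalues.

On square-free polynomials in the variables `x_i`, `i ∈ S`, the lowering operator `D = ∑ ∂ᵢ` and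
the raising operator `E`, multiplication by `∑ xᵢ` with removal of squares, satisfy the relations
of `sl₂` (`lowering_raising`). The sum of the transpositions of `S`, each counted twice, equals `2
E D` plus a scalar that depends only on `|S|` and the degree (`swapSum_eq_raising_lowering`).
Hence it acts on lowest weight vectors (`D f = 0`) of degree `j`, and on everything obtained from
them by raising, by a number `swapEigenvalue |S| j`, and these numbers are distinct for `2 j ≤
|S|`.

For a set `P` of indices let the path vector of `P` be built by adding one variable at a time: a
variable `x_i` with `i ∉ P` changes nothing, and for `i ∈ P` a vector `g` of degree `k` in the `l`
variables before `x_i` is replaced by `E g - (l - 2 k) x_i g`. Path vectors are lowest weight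
vectors. The branching rule in this language is `levelVector_castSucc_mem_span`: if `P` runs over
the ballot sequences, the raised path vectors on level `l`, times monomials in the other
variables, span all square-free polynomials. Unfolding the recursion expresses path vectors
through products of differences, and shows that the sum `F_u` is the path vector of the second row
of `u`, raised `m - k` times (`pathVector_eq_pseudoMonomialSum`,
`pseudoMonomialSum_eq_raising_pow`).

The Specht module of the shape `(l - k, k)` is spanned by products of differences, which are
lowest weight vectors. So the sum of transpositions acts on its isotypic component by the scalar
`swapEigenvalue l k`. Conversely an eigenvector is a combination of the raised path vectors with
that eigenvalue, and each of these lies in the image of the Specht module under an equivariant map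
`f ↦ Eʳ f · x_J`, which is injective by the `sl₂` relations. This proves
`mem_isotypicSubspace_restrictedRep_iff`; neither the irreducibility of Specht modules nor
complete reducibility is needed.

Consequently `V_u` is a joint eigenspace of the sums of transpositions of all initial segments.
The vectors `F_u` are joint eigenvectors spanning `H_{n,m}^k`, and a ballot sequence is determined
by its eigenvalues, so `V_u` is the line through `F_u`.
-/

namespace TwoRowTensor

/-! ### Eigenvectors and spans -/

/-- If `f` lies in the span of eigenvectors `v i` of `T` and is itself an eigenvector, then only
the `v i` with the eigenvalue of `f` are needed. -/
theorem mem_span_of_eigenvector {V ι : Type*} [AddCommGroup V] [Module ℂ V] (T : Module.End ℂ V)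
    (v : ι → V) (χ : ι → ℂ) (s : Set ι) (hv : ∀ i ∈ s, T (v i) = χ i • v i) {f : V} {c : ℂ}
    (hf : f ∈ Submodule.span ℂ (v '' s)) (hTf : T f = c • f) :
    f ∈ Submodule.span ℂ (v '' {i ∈ s | χ i = c}) := by
  have hs : s = {i ∈ s | χ i = c} ∪ {i ∈ s | χ i ≠ c} := by
    ext i; by_cases h : χ i = c <;> simp [h]
  rw [hs, Set.image_union, Submodule.span_union] at hf
  obtain ⟨a, ha, b, hb, rfl⟩ := Submodule.mem_sup.mp hf
  have ha' : T a = c • a := by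
    have : Submodule.span ℂ (v '' {i ∈ s | χ i = c}) ≤ T.eigenspace c := by
      rw [Submodule.span_le]
      rintro _ ⟨i, ⟨hi, rfl⟩, rfl⟩
      exact Module.End.mem_eigenspace_iff.mpr (hv i hi)
    exact Module.End.mem_eigenspace_iff.mp (this ha)
  have hb' : T b = c • b := by
    rw [map_add, ha', smul_add] at hTf
    exact add_left_cancel hTf
  have hb2 : b ∈ ⨆ μ, ⨆ _ : μ ≠ c, T.eigenspace μ := by
    have : Submodule.span ℂ (v '' {i ∈ s | χ i ≠ c}) ≤ ⨆ μ, ⨆ _ : μ ≠ c, T.eigenspace μ := by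
      rw [Submodule.span_le]
      rintro _ ⟨i, ⟨hi, hic⟩, rfl⟩
      exact Submodule.mem_iSup_of_mem (χ i) (Submodule.mem_iSup_of_mem hic
        (Module.End.mem_eigenspace_iff.mpr (hv i hi)))
    exact this hb
  have hb0 : b = 0 := by
    have := (Module.End.eigenspaces_iSupIndep T) c
    exact (Submodule.disjoint_def.mp this) b (Module.End.mem_eigenspace_iff.mpr hb') hb2
  simpa [hb0] using ha

/-- The version of `mem_span_of_eigenvector` for finitely many operators, which need not commute. -/
theorem mem_span_of_joint_eigenvector {V ι κ : Type*} [AddCommGroup V] [Module ℂ V]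
    (T : κ → Module.End ℂ V) (v : ι → V) (χ : ι → κ → ℂ) (t : Finset κ) (s : Set ι)
    (hv : ∀ i ∈ s, ∀ a ∈ t, T a (v i) = χ i a • v i) {f : V} {c : κ → ℂ}
    (hf : f ∈ Submodule.span ℂ (v '' s)) (hTf : ∀ a ∈ t, T a f = c a • f) :
    f ∈ Submodule.span ℂ (v '' {i ∈ s | ∀ a ∈ t, χ i a = c a}) := by
  classical
  induction t using Finset.induction_on with
  | empty => simpa using hf
  | insert a t _ ih =>
    have h1 := ih (fun i hi b hb => hv i hi b (Finset.mem_insert_of_mem hb))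
      (fun b hb => hTf b (Finset.mem_insert_of_mem hb))
    have h2 := mem_span_of_eigenvector (T a) v (fun i => χ i a) _
      (fun i hi => hv i hi.1 a (Finset.mem_insert_self a t)) h1
      (hTf a (Finset.mem_insert_self a t))
    refine Submodule.span_mono (Set.image_mono ?_) h2
    rintro i ⟨⟨hi, hit⟩, hia⟩
    refine ⟨hi, fun b hb => ?_⟩
    rcases Finset.mem_insert.mp hb with rfl | hb
    · exact hia
    · exact hit b hb

/-! ### Isotypic components -/

section Isotypic

variable {G V W : Type*} [Group G] [AddCommGroup V] [Module ℂ V] [AddCommGroup W] [Module ℂ W]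

/-- An element of the group algebra that acts on `σ` by a scalar acts by the same scalar on the
isotypic component of type `σ`. -/
theorem asAlgebraHom_apply_of_mem_isotypicSubspace {ρ : Representation ℂ G V}
    {σ : Representation ℂ G W} (a : MonoidAlgebra ℂ G) (c : ℂ)
    (ha : ∀ w, σ.asAlgebraHom a w = c • w) {v : V} (hv : v ∈ isotypicSubspace ρ σ) :
    ρ.asAlgebraHom a v = c • v := by
  let N : Submodule ℂ V := LinearMap.ker (ρ.asAlgebraHom a - c • LinearMap.id)
  suffices h : ∀ x ∈ isotypicComponent (MonoidAlgebra ℂ G) ρ.asModule σ.asModule,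
      ρ.asModuleEquiv x ∈ N by
    have := h _ hv
    simpa [N, sub_eq_zero] using! this
  intro x hx
  rw [isotypicComponent, sSup_eq_iSup] at hx
  refine Submodule.iSup_induction' (p := fun M : Submodule (MonoidAlgebra ℂ G) ρ.asModule =>
    ⨆ (_ : M ∈ {m : Submodule (MonoidAlgebra ℂ G) ρ.asModule |
      Nonempty (m ≃ₗ[MonoidAlgebra ℂ G] σ.asModule)}), M)
    (motive := fun x _ => ρ.asModuleEquiv x ∈ N) ?_ ?_ ?_ hx
  · intro M x hx
    by_cases hM : Nonempty (M ≃ₗ[MonoidAlgebra ℂ G] σ.asModule)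
    · obtain ⟨e⟩ := hM
      have hxM : x ∈ M := by
        simpa [show Nonempty (M ≃ₗ[MonoidAlgebra ℂ G] σ.asModule) from ⟨e⟩] using hx
      have key : a • (⟨x, hxM⟩ : M) = algebraMap ℂ (MonoidAlgebra ℂ G) c • ⟨x, hxM⟩ := by
        apply e.injective
        rw [map_smul, map_smul]
        apply σ.asModuleEquiv.injective
        rw [Representation.asModuleEquiv_map_smul, Representation.asModuleEquiv_map_smul, ha,
          AlgHom.commutes, Module.algebraMap_end_apply]
      have key2 := congrArg ρ.asModuleEquiv (congrArg Subtype.val key)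
      simp only [Submodule.coe_smul] at key2
      rw [Representation.asModuleEquiv_map_smul, Representation.asModuleEquiv_map_smul,
          AlgHom.commutes, Module.algebraMap_end_apply] at key2
      simp [N, key2]
    · have : x = 0 := by simpa [hM] using hx
      simp [this]
  · simp
  · intro x y _ _ hx hy
    rw [map_add]
    exact N.add_mem hx hy

/-- The image of an injective equivariant map `σ → ρ` lies in the isotypic component. -/
theorem apply_mem_isotypicSubspace {ρ : Representation ℂ G V} {σ : Representation ℂ G W}
    (φ : W →ₗ[ℂ] V) (hinj : Function.Injective φ) (hφ : ∀ g w, φ (σ g w) = ρ g (φ w)) (w : W) :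
    φ w ∈ isotypicSubspace ρ σ := by
  let ψ : σ.asModule →ₗ[MonoidAlgebra ℂ G] ρ.asModule :=
    { toFun := fun x => ρ.asModuleEquiv.symm (φ (σ.asModuleEquiv x))
      map_add' := fun x y => by simp
      map_smul' := fun r x => by
        apply ρ.asModuleEquiv.injective
        rw [RingHom.id_apply, LinearEquiv.apply_symm_apply, Representation.asModuleEquiv_map_smul,
          Representation.asModuleEquiv_map_smul, LinearEquiv.apply_symm_apply]
        induction r using MonoidAlgebra.induction_linear with
        | zero => simp
        | add x y hx hy => simp only [map_add, LinearMap.add_apply, hx, hy]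
        | single g a => simp [Representation.asAlgebraHom_single, hφ] }
  have hψ : Function.Injective ψ := fun x y h => by
    apply σ.asModuleEquiv.injective
    exact hinj (ρ.asModuleEquiv.symm.injective h)
  have hle : LinearMap.range ψ ≤ isotypicComponent (MonoidAlgebra ℂ G) ρ.asModule σ.asModule :=
    le_sSup ⟨(LinearEquiv.ofInjective ψ hψ).symm⟩
  exact hle ⟨σ.asModuleEquiv.symm w, by rfl⟩

end Isotypic

/-! ### Raising and lowering operators -/

section Operators

variable {n : ℕ}

/-- The lowering operator `∑ i ∈ S, ∂ᵢ`. -/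
noncomputable def lowering (S : Finset (Fin n)) :
    Derivation ℂ (MvPolynomial (Fin n) ℂ) (MvPolynomial (Fin n) ℂ) :=
  MvPolynomial.mkDerivation ℂ fun i => if i ∈ S then 1 else 0

/-- The derivation `∑ i ∈ S, xᵢ² ∂ᵢ`, the correction term of the raising operator. -/
noncomputable def squaring (S : Finset (Fin n)) :
    Derivation ℂ (MvPolynomial (Fin n) ℂ) (MvPolynomial (Fin n) ℂ) :=
  MvPolynomial.mkDerivation ℂ fun i => if i ∈ S then MvPolynomial.X i ^ 2 else 0

/-- The Euler operator `∑ i ∈ S, xᵢ ∂ᵢ`, which measures the degree in the variables of `S`. -/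
noncomputable def euler (S : Finset (Fin n)) :
    Derivation ℂ (MvPolynomial (Fin n) ℂ) (MvPolynomial (Fin n) ℂ) :=
  MvPolynomial.mkDerivation ℂ fun i => if i ∈ S then MvPolynomial.X i else 0

/-- The raising operator `∑ i ∈ S, (xᵢ - xᵢ² ∂ᵢ)`. On square-free polynomials it is the
multiplication by `∑ i ∈ S, xᵢ` followed by the removal of all monomials that are not
square-free; writing it as a differential operator makes the Leibniz rule available. -/
noncomputable def raising (S : Finset (Fin n)) : Module.End ℂ (MvPolynomial (Fin n) ℂ) :=
  LinearMap.mulLeft ℂ (∑ i ∈ S, MvPolynomial.X i) - (squaring S).toLinearMap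

/-- The sum of the transpositions `(i j)` over all ordered pairs `i, j ∈ S` (with the identity for
`i = j`), acting by substitution of variables. -/
noncomputable def swapSum (S : Finset (Fin n)) : Module.End ℂ (MvPolynomial (Fin n) ℂ) :=
  ∑ i ∈ S, ∑ j ∈ S, polyRep n (Equiv.swap i j)

/-- The span of the square-free monomials of degree `q` in the variables of `S`. -/
noncomputable def squareFree (S : Finset (Fin n)) (q : ℕ) :
    Submodule ℂ (MvPolynomial (Fin n) ℂ) :=
  Submodule.span ℂ {f | ∃ I : Finset (Fin n), I ⊆ S ∧ I.card = q ∧ f = monomialOf I}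

theorem forms_eq_squareFree (m : ℕ) : Forms n m = squareFree Finset.univ m := by
  simp [Forms, formSubrep, squareFree]

theorem raising_apply (S : Finset (Fin n)) (f : MvPolynomial (Fin n) ℂ) :
    raising S f = (∑ i ∈ S, MvPolynomial.X i) * f - squaring S f := rfl

theorem swapSum_apply (S : Finset (Fin n)) (f : MvPolynomial (Fin n) ℂ) :
    swapSum S f = ∑ i ∈ S, ∑ j ∈ S, polyRep n (Equiv.swap i j) f := by
  simp [swapSum]

theorem polyRep_apply (σ : Equiv.Perm (Fin n)) (f : MvPolynomial (Fin n) ℂ) :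
    polyRep n σ f = MvPolynomial.rename σ f := rfl

@[simp] theorem lowering_X (S : Finset (Fin n)) (i : Fin n) :
    lowering S (MvPolynomial.X i) = if i ∈ S then 1 else 0 := by simp [lowering]

@[simp] theorem squaring_X (S : Finset (Fin n)) (i : Fin n) :
    squaring S (MvPolynomial.X i) = if i ∈ S then MvPolynomial.X i ^ 2 else 0 := by simp [squaring]

@[simp] theorem euler_X (S : Finset (Fin n)) (i : Fin n) :
    euler S (MvPolynomial.X i) = if i ∈ S then MvPolynomial.X i else 0 := by simp [euler]

theorem derivation_prod_of_eigen {ι : Type*}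
    (d : Derivation ℂ (MvPolynomial (Fin n) ℂ) (MvPolynomial (Fin n) ℂ))
    (s : Finset ι) (f a : ι → MvPolynomial (Fin n) ℂ) (h : ∀ i ∈ s, d (f i) = a i * f i) :
    d (∏ i ∈ s, f i) = (∑ i ∈ s, a i) * ∏ i ∈ s, f i := by
  classical
  induction s using Finset.induction_on with
  | empty => simp
  | insert i s hi ih =>
    rw [Finset.prod_insert hi, Finset.sum_insert hi, Derivation.leibniz,
      ih fun j hj => h j (Finset.mem_insert_of_mem hj), h i (Finset.mem_insert_self i s)]
    simp only [smul_eq_mul]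
    ring

theorem monomialOf_insert {I : Finset (Fin n)} {i : Fin n} (hi : i ∉ I) :
    monomialOf (insert i I) = MvPolynomial.X i * monomialOf I := Finset.prod_insert hi

theorem monomialOf_union {I J : Finset (Fin n)} (h : Disjoint I J) :
    monomialOf (I ∪ J) = monomialOf I * monomialOf J := Finset.prod_union h

theorem polyRep_monomialOf (σ : Equiv.Perm (Fin n)) (I : Finset (Fin n)) :
    polyRep n σ (monomialOf I) = monomialOf (I.map σ.toEmbedding) := by
  simp [polyRep, monomialOf]

theorem lowering_monomialOf (S I : Finset (Fin n)) :
    lowering S (monomialOf I) = ∑ i ∈ I with i ∈ S, monomialOf (I.erase i) := by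
  induction I using Finset.induction_on with
  | empty => simp [monomialOf]
  | insert a I ha ih =>
    rw [monomialOf_insert ha, Derivation.leibniz, ih, Finset.sum_filter, Finset.sum_filter,
      Finset.sum_insert ha, Finset.erase_insert ha, add_comm]
    congr 1
    · by_cases h : a ∈ S <;> simp [h]
    · rw [smul_eq_mul, Finset.mul_sum]
      refine Finset.sum_congr rfl fun i hi => ?_
      have hia : a ≠ i := fun h => ha (h ▸ hi)
      rw [Finset.erase_insert_of_ne hia, monomialOf_insert fun h => ha (Finset.mem_of_mem_erase h)]
      simp

theorem squaring_monomialOf (S I : Finset (Fin n)) :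
    squaring S (monomialOf I) = (∑ i ∈ I with i ∈ S, MvPolynomial.X i) * monomialOf I := by
  rw [Finset.sum_filter]
  refine derivation_prod_of_eigen _ _ _ _ fun i _ => ?_
  by_cases h : i ∈ S <;> simp [h, sq]

theorem euler_monomialOf (S I : Finset (Fin n)) :
    euler S (monomialOf I) = ((I.filter (· ∈ S)).card : ℂ) • monomialOf I := by
  have : euler S (monomialOf I) = (∑ i ∈ I, if i ∈ S then 1 else 0) * monomialOf I := by
    refine derivation_prod_of_eigen _ _ _ _ fun i _ => ?_
    by_cases h : i ∈ S <;> simp [h]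
  rw [this, Finset.sum_boole, MvPolynomial.smul_eq_C_mul]
  simp

theorem raising_monomialOf (S I : Finset (Fin n)) :
    raising S (monomialOf I) = ∑ c ∈ S \ I, monomialOf (insert c I) := by
  have h : ∑ i ∈ S, (MvPolynomial.X i : MvPolynomial (Fin n) ℂ)
      = ∑ i ∈ S \ I, MvPolynomial.X i + ∑ i ∈ I with i ∈ S, MvPolynomial.X i := by
    rw [Finset.filter_mem_eq_inter, Finset.inter_comm, add_comm, Finset.sum_inter_add_sum_sdiff]
  rw [raising_apply, squaring_monomialOf, h, add_mul, add_sub_cancel_right, Finset.sum_mul]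
  refine Finset.sum_congr rfl fun c hc => ?_
  rw [monomialOf_insert (Finset.mem_sdiff.mp hc).2]

/-! ### Square-free polynomials -/

theorem monomialOf_mem_squareFree {S I : Finset (Fin n)} (h : I ⊆ S) :
    monomialOf I ∈ squareFree S I.card :=
  Submodule.subset_span ⟨I, h, rfl, rfl⟩

theorem squareFree_mono {S S' : Finset (Fin n)} (h : S ⊆ S') (q : ℕ) :
    squareFree S q ≤ squareFree S' q :=
  Submodule.span_mono fun _ ⟨I, hI, hq, hf⟩ => ⟨I, hI.trans h, hq, hf⟩

/-- A linear identity on `squareFree S q` may be checked on monomials. -/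
theorem eqOn_squareFree {M : Type*} [AddCommGroup M] [Module ℂ M] {S : Finset (Fin n)} {q : ℕ}
    {φ ψ : MvPolynomial (Fin n) ℂ →ₗ[ℂ] M}
    (h : ∀ I ⊆ S, I.card = q → φ (monomialOf I) = ψ (monomialOf I))
    {f : MvPolynomial (Fin n) ℂ} (hf : f ∈ squareFree S q) : φ f = ψ f := by
  refine LinearMap.eqOn_span (s := {f | ∃ I : Finset (Fin n), I ⊆ S ∧ I.card = q ∧
    f = monomialOf I}) ?_ hf
  rintro _ ⟨I, hI, hq, rfl⟩
  exact h I hI hq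

theorem mul_mem_squareFree {S S' : Finset (Fin n)} (hd : Disjoint S S') {q q' : ℕ}
    {f g : MvPolynomial (Fin n) ℂ} (hf : f ∈ squareFree S q) (hg : g ∈ squareFree S' q') :
    f * g ∈ squareFree (S ∪ S') (q + q') := by
  have h := Submodule.mul_mem_mul hf hg
  rw [squareFree, squareFree, Submodule.span_mul_span] at h
  refine Submodule.span_mono ?_ h
  rintro _ ⟨_, ⟨I, hI, rfl, rfl⟩, _, ⟨J, hJ, rfl, rfl⟩, rfl⟩
  have hIJ : Disjoint I J :=
    Finset.disjoint_of_subset_left hI (Finset.disjoint_of_subset_right hJ hd)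
  exact ⟨I ∪ J, Finset.union_subset_union hI hJ, Finset.card_union_of_disjoint hIJ,
    (monomialOf_union hIJ).symm⟩

theorem raising_mem_squareFree {S S' : Finset (Fin n)} (h : S ⊆ S') {q : ℕ}
    {f : MvPolynomial (Fin n) ℂ} (hf : f ∈ squareFree S' q) :
    raising S f ∈ squareFree S' (q + 1) := by
  have : squareFree S' q ≤ (squareFree S' (q + 1)).comap (raising S) := by
    rw [squareFree, Submodule.span_le]
    rintro _ ⟨I, hI, rfl, rfl⟩
    rw [SetLike.mem_coe, Submodule.mem_comap, raising_monomialOf]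
    refine Submodule.sum_mem _ fun c hc => ?_
    obtain ⟨hcS, hcI⟩ := Finset.mem_sdiff.mp hc
    rw [← Finset.card_insert_of_notMem hcI]
    exact monomialOf_mem_squareFree (Finset.insert_subset (h hcS) hI)
  exact this hf

theorem raising_pow_mem_squareFree {S S' : Finset (Fin n)} (h : S ⊆ S') {q : ℕ} (r : ℕ)
    {f : MvPolynomial (Fin n) ℂ} (hf : f ∈ squareFree S' q) :
    (raising S ^ r) f ∈ squareFree S' (q + r) := by
  induction r with
  | zero => simpa using hf
  | succ r ih =>
    rw [pow_succ', Module.End.mul_apply]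
    exact raising_mem_squareFree h ih

theorem squaring_eq_zero {S S' : Finset (Fin n)} (hd : Disjoint S S') {q : ℕ}
    {f : MvPolynomial (Fin n) ℂ} (hf : f ∈ squareFree S' q) : squaring S f = 0 := by
  refine eqOn_squareFree (φ := (squaring S).toLinearMap) (ψ := 0) (fun I hI _ => ?_) hf
  have : I.filter (· ∈ S) = ∅ := Finset.filter_eq_empty_iff.mpr
    fun i hi hiS => Finset.disjoint_left.mp hd hiS (hI hi)
  simp [squaring_monomialOf, this]

theorem lowering_eq_zero {S S' : Finset (Fin n)} (hd : Disjoint S S') {q : ℕ}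
    {f : MvPolynomial (Fin n) ℂ} (hf : f ∈ squareFree S' q) : lowering S f = 0 := by
  refine eqOn_squareFree (φ := (lowering S).toLinearMap) (ψ := 0) (fun I hI _ => ?_) hf
  have : I.filter (· ∈ S) = ∅ := Finset.filter_eq_empty_iff.mpr
    fun i hi hiS => Finset.disjoint_left.mp hd hiS (hI hi)
  simp [lowering_monomialOf, this]

theorem euler_eq_smul {S S' : Finset (Fin n)} (h : S' ⊆ S) {q : ℕ}
    {f : MvPolynomial (Fin n) ℂ} (hf : f ∈ squareFree S' q) : euler S f = (q : ℂ) • f := by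
  refine eqOn_squareFree (φ := (euler S).toLinearMap) (ψ := (q : ℂ) • LinearMap.id)
    (fun I hI hq => ?_) hf
  have : I.filter (· ∈ S) = I := Finset.filter_true_of_mem fun i hi => h (hI hi)
  simp [euler_monomialOf, this, hq]

theorem raising_mul (S : Finset (Fin n)) (f g : MvPolynomial (Fin n) ℂ) :
    raising S (f * g) = raising S f * g - f * squaring S g := by
  simp only [raising_apply, Derivation.leibniz, smul_eq_mul]
  ring

theorem raising_insert {S : Finset (Fin n)} {i : Fin n} (hi : i ∉ S)
    (f : MvPolynomial (Fin n) ℂ) : raising (insert i S) f = raising S f + raising {i} f := by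
  have : squaring (insert i S) = squaring S + squaring {i} := by
    refine MvPolynomial.derivation_ext fun j => ?_
    by_cases hj : j = i
    · subst hj; simp [hi]
    · simp [hj]
  simp only [raising_apply, Finset.sum_insert hi, this, Derivation.add_apply,
    Finset.sum_singleton]
  ring

theorem lowering_insert {S : Finset (Fin n)} {i : Fin n} (hi : i ∉ S)
    (f : MvPolynomial (Fin n) ℂ) : lowering (insert i S) f = lowering S f + lowering {i} f := by
  have : lowering (insert i S) = lowering S + lowering {i} := by
    refine MvPolynomial.derivation_ext fun j => ?_
    by_cases hj : j = i
    · subst hj; simp [hi]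
    · simp [hj]
  simp only [this, Derivation.add_apply]

/-! ### The `sl₂` relations -/

theorem lowering_raising (S : Finset (Fin n)) (f : MvPolynomial (Fin n) ℂ) :
    lowering S (raising S f) =
      raising S (lowering S f) + (S.card : ℂ) • f - (2 : ℂ) • euler S f := by
  have h : ⁅lowering S, squaring S⁆ = (2 : ℂ) • euler S := by
    refine MvPolynomial.derivation_ext fun j => ?_
    by_cases hj : j ∈ S
    · simp [Derivation.commutator_apply, hj, sq, MvPolynomial.smul_eq_C_mul]
      rw [show (MvPolynomial.C (2 : ℂ) : MvPolynomial (Fin n) ℂ) = 2 from map_ofNat _ 2]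
      ring
    · simp [Derivation.commutator_apply, hj]
  have h2 := congrArg (fun d => d f) h
  simp only [Derivation.commutator_apply, Derivation.smul_apply] at h2
  have h3 : lowering S (∑ i ∈ S, MvPolynomial.X i) = (S.card : MvPolynomial (Fin n) ℂ) := by
    rw [map_sum, Finset.sum_congr rfl fun i hi => by rw [lowering_X, if_pos hi]]
    simp
  rw [raising_apply, map_sub, Derivation.leibniz, h3, raising_apply, ← h2]
  simp only [smul_eq_mul, MvPolynomial.smul_eq_C_mul, map_natCast]
  ring

theorem lowering_raising_pow {S : Finset (Fin n)} {j : ℕ} {f : MvPolynomial (Fin n) ℂ}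
    (hf : f ∈ squareFree S j) (h0 : lowering S f = 0) (r : ℕ) :
    lowering S ((raising S ^ (r + 1)) f) =
      ((r + 1) * ((S.card : ℂ) - 2 * j - r)) • (raising S ^ r) f := by
  induction r with
  | zero =>
    simp only [zero_add, pow_one, pow_zero, Module.End.one_apply]
    rw [lowering_raising, h0, euler_eq_smul subset_rfl hf]
    simp only [map_zero]
    module
  | succ r ih =>
    rw [pow_succ', Module.End.mul_apply, lowering_raising, ih, map_smul,
      euler_eq_smul subset_rfl (raising_pow_mem_squareFree subset_rfl (r + 1) hf),
      ← Module.End.mul_apply, ← pow_succ']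
    push_cast
    module

/-- A lowest weight vector of degree `j` generates a string of length `|S| - 2 j + 1`. -/
theorem raising_pow_ne_zero {S : Finset (Fin n)} {j : ℕ} {f : MvPolynomial (Fin n) ℂ}
    (hf : f ∈ squareFree S j) (h0 : lowering S f = 0) (hne : f ≠ 0) {r : ℕ}
    (hr : r + 2 * j ≤ S.card) : (raising S ^ r) f ≠ 0 := by
  induction r with
  | zero => simpa using hne
  | succ r ih =>
    intro h
    have h1 := lowering_raising_pow hf h0 r
    rw [h, map_zero, eq_comm, smul_eq_zero] at h1
    rcases h1 with h1 | h1
    · rcases mul_eq_zero.mp h1 with h2 | h2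
      · exact absurd h2 (by exact_mod_cast Nat.succ_ne_zero r)
      · have : (S.card : ℂ) = 2 * j + r := by linear_combination h2
        have : S.card = 2 * j + r := by exact_mod_cast this
        omega
    · exact ih (by omega) h1

/-! ### The sum of transpositions -/

theorem polyRep_raising (σ : Equiv.Perm (Fin n)) {S : Finset (Fin n)}
    (hS : S.map σ.toEmbedding = S) (f : MvPolynomial (Fin n) ℂ) :
    polyRep n σ (raising S f) = raising S (polyRep n σ f) := by
  have hmem : ∀ i, σ i ∈ S ↔ i ∈ S := fun i => by
    conv_lhs => rw [← hS]
    simp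
  have h1 : MvPolynomial.rename σ (∑ i ∈ S, (MvPolynomial.X i : MvPolynomial (Fin n) ℂ)) =
      ∑ i ∈ S, MvPolynomial.X i := by
    conv_rhs => rw [← hS]
    simp
  have h2 : MvPolynomial.rename σ (squaring S f) = squaring S (MvPolynomial.rename σ f) := by
    induction f using MvPolynomial.induction_on with
    | C a => simp [MvPolynomial.derivation_C]
    | add p q hp hq => simp [hp, hq]
    | mul_X p i hp =>
      simp only [Derivation.leibniz, map_add, map_mul, smul_eq_mul, hp, MvPolynomial.rename_X,
        squaring_X, hmem]
      by_cases h : i ∈ S <;> simp [h]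
  simp only [polyRep_apply, raising_apply, map_sub, map_mul, h1, h2]

theorem polyRep_raising_pow (σ : Equiv.Perm (Fin n)) {S : Finset (Fin n)}
    (hS : S.map σ.toEmbedding = S) (r : ℕ) (f : MvPolynomial (Fin n) ℂ) :
    polyRep n σ ((raising S ^ r) f) = (raising S ^ r) (polyRep n σ f) := by
  induction r with
  | zero => simp
  | succ r ih =>
    rw [pow_succ', Module.End.mul_apply, polyRep_raising σ hS, ih, Module.End.mul_apply]

theorem map_swap_eq {S : Finset (Fin n)} {i j : Fin n} (h : i ∈ S ↔ j ∈ S) :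
    S.map (Equiv.swap i j).toEmbedding = S := by
  ext a
  simp only [Finset.mem_map_equiv, Equiv.symm_swap]
  rcases eq_or_ne a i with rfl | hi
  · simp [h]
  rcases eq_or_ne a j with rfl | hj
  · simp [h]
  · rw [Equiv.swap_apply_of_ne_of_ne hi hj]

theorem polyRep_eq_self (σ : Equiv.Perm (Fin n)) {S : Finset (Fin n)} {q : ℕ}
    (hσ : ∀ i ∈ S, σ i = i) {f : MvPolynomial (Fin n) ℂ} (hf : f ∈ squareFree S q) :
    polyRep n σ f = f := by
  refine eqOn_squareFree (φ := polyRep n σ) (ψ := LinearMap.id) (fun I hI _ => ?_) hf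
  simp only [polyRep_apply, monomialOf, map_prod, MvPolynomial.rename_X, LinearMap.id_apply]
  exact Finset.prod_congr rfl fun i hi => by rw [hσ i (hI hi)]

/-- The sum of transpositions of `S` commutes with the raising operators of larger sets. -/
theorem swapSum_raising_pow {S S' : Finset (Fin n)} (h : S ⊆ S') (r : ℕ)
    (f : MvPolynomial (Fin n) ℂ) :
    swapSum S ((raising S' ^ r) f) = (raising S' ^ r) (swapSum S f) := by
  simp only [swapSum_apply, map_sum]
  refine Finset.sum_congr rfl fun i hi => Finset.sum_congr rfl fun j hj => ?_
  exact polyRep_raising_pow _ (map_swap_eq (by simp [h hi, h hj])) r f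

/-- The sum of transpositions of `S` is linear over the polynomials in the other variables. -/
theorem swapSum_mul {S S' : Finset (Fin n)} (hd : Disjoint S S') {q : ℕ}
    {g : MvPolynomial (Fin n) ℂ} (hg : g ∈ squareFree S' q) (f : MvPolynomial (Fin n) ℂ) :
    swapSum S (f * g) = swapSum S f * g := by
  simp only [swapSum_apply, Finset.sum_mul]
  refine Finset.sum_congr rfl fun i hi => Finset.sum_congr rfl fun j hj => ?_
  have : polyRep n (Equiv.swap i j) g = g := polyRep_eq_self _ (fun a ha => by
    apply Equiv.swap_apply_of_ne_of_ne
    · rintro rfl; exact Finset.disjoint_left.mp hd hi ha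
    · rintro rfl; exact Finset.disjoint_left.mp hd hj ha) hg
  rw [polyRep_apply, map_mul, ← polyRep_apply, ← polyRep_apply, this]

/-- The eigenvalue of `swapSum S`, `|S| = l`, on lowest weight vectors of degree `j`. -/
def swapEigenvalue (l j : ℕ) : ℂ := ((l : ℂ) - j) ^ 2 + (j : ℂ) ^ 2 - 2 * j

theorem swapEigenvalue_injective {l j j' : ℕ} (hj : 2 * j ≤ l) (hj' : 2 * j' ≤ l)
    (h : swapEigenvalue l j = swapEigenvalue l j') : j = j' := by
  have h1 : ((j' : ℂ) - j) * (l - j - j' + 1) = 0 := by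
    unfold swapEigenvalue at h
    linear_combination h / 2
  rcases mul_eq_zero.mp h1 with h2 | h2
  · have : (j' : ℂ) = j := by linear_combination h2
    exact_mod_cast this.symm
  · have : (l : ℂ) + 1 = j + j' := by linear_combination h2
    have : l + 1 = j + j' := by exact_mod_cast this
    omega

theorem swapSum_eq_raising_lowering {S : Finset (Fin n)} {q : ℕ} {f : MvPolynomial (Fin n) ℂ}
    (hf : f ∈ squareFree S q) :
    swapSum S f = (2 : ℂ) • raising S (lowering S f) + swapEigenvalue S.card q • f := by
  refine eqOn_squareFree (φ := swapSum S)
    (ψ := (2 : ℂ) • (raising S ∘ₗ (lowering S).toLinearMap) +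
      swapEigenvalue S.card q • LinearMap.id) (fun I hI hq => ?_) hf
  -- the part of both sides in which one index of `I` is replaced by one outside
  set B : MvPolynomial (Fin n) ℂ :=
    ∑ i ∈ I, ∑ c ∈ S \ I, monomialOf (insert c (I.erase i)) with hB
  have hIS : I.filter (· ∈ S) = I := Finset.filter_true_of_mem fun i hi => hI hi
  have h1 : raising S (lowering S (monomialOf I)) = (q : ℂ) • monomialOf I + B := by
    rw [lowering_monomialOf, hIS, map_sum, hB, ← hq]
    have : ∀ i ∈ I, raising S (monomialOf (I.erase i)) =
        monomialOf I + ∑ c ∈ S \ I, monomialOf (insert c (I.erase i)) := fun i hi => by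
      have : S \ I.erase i = insert i (S \ I) := by
        ext a
        by_cases ha : a = i
        · subst ha; simp [hI hi]
        · simp [ha]
      rw [raising_monomialOf, this, Finset.sum_insert (by simp [hi]), Finset.insert_erase hi]
    rw [Finset.sum_congr rfl this, Finset.sum_add_distrib, Finset.sum_const, Nat.cast_smul_eq_nsmul]
  have hin : ∀ i ∈ I, ∀ j ∈ I, polyRep n (Equiv.swap i j) (monomialOf I) = monomialOf I :=
    fun i hi j hj => by rw [polyRep_monomialOf, map_swap_eq (by simp [hi, hj])]
  have hout : ∀ i ∈ S \ I, ∀ j ∈ S \ I, polyRep n (Equiv.swap i j) (monomialOf I) = monomialOf I :=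
    fun i hi j hj => by
      rw [polyRep_monomialOf, map_swap_eq (by
        simp [(Finset.mem_sdiff.mp hi).2, (Finset.mem_sdiff.mp hj).2])]
  have hmix : ∀ i ∈ I, ∀ j ∈ S \ I, polyRep n (Equiv.swap i j) (monomialOf I) =
      monomialOf (insert j (I.erase i)) := fun i hi j hj => by
    have hj' := (Finset.mem_sdiff.mp hj).2
    have hij : i ≠ j := fun h => hj' (h ▸ hi)
    rw [polyRep_monomialOf]
    congr 1
    ext a
    simp only [Finset.mem_map_equiv, Equiv.symm_swap, Finset.mem_insert, Finset.mem_erase]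
    rcases eq_or_ne a i with rfl | hai
    · simp [hj', hij]
    rcases eq_or_ne a j with rfl | haj
    · simp [hi]
    · simp [Equiv.swap_apply_of_ne_of_ne hai haj, hai, haj]
  have hsplit : ∀ g : Fin n → MvPolynomial (Fin n) ℂ,
      ∑ i ∈ S, g i = ∑ i ∈ I, g i + ∑ i ∈ S \ I, g i := fun g => by
    rw [add_comm, Finset.sum_sdiff hI]
  have hcard : ((S \ I).card : ℂ) = S.card - q := by
    rw [Finset.card_sdiff_of_subset hI, Nat.cast_sub (Finset.card_le_card hI), hq]
  have h2 : swapSum S (monomialOf I) =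
      ((q : ℂ) ^ 2 + ((S.card : ℂ) - q) ^ 2) • monomialOf I + (2 : ℂ) • B := by
    have e1 : ∑ i ∈ I, ∑ j ∈ I, polyRep n (Equiv.swap i j) (monomialOf I) =
        ((q : ℂ) ^ 2) • monomialOf I := by
      rw [Finset.sum_congr rfl fun i hi => Finset.sum_congr rfl fun j hj => hin i hi j hj]
      simp only [Finset.sum_const, hq, ← Nat.cast_smul_eq_nsmul ℂ, smul_smul, sq]
    have e2 : ∑ i ∈ S \ I, ∑ j ∈ S \ I, polyRep n (Equiv.swap i j) (monomialOf I) =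
        (((S.card : ℂ) - q) ^ 2) • monomialOf I := by
      rw [Finset.sum_congr rfl fun i hi => Finset.sum_congr rfl fun j hj => hout i hi j hj]
      simp only [Finset.sum_const, ← Nat.cast_smul_eq_nsmul ℂ, hcard, smul_smul, sq]
    have e3 : ∑ i ∈ I, ∑ j ∈ S \ I, polyRep n (Equiv.swap i j) (monomialOf I) = B :=
      Finset.sum_congr rfl fun i hi => Finset.sum_congr rfl fun j hj => hmix i hi j hj
    have e4 : ∑ i ∈ S \ I, ∑ j ∈ I, polyRep n (Equiv.swap i j) (monomialOf I) = B := by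
      rw [Finset.sum_comm, ← e3]
      simp only [Equiv.swap_comm]
    rw [swapSum_apply, hsplit]
    simp only [hsplit, Finset.sum_add_distrib, e1, e2, e3, e4]
    module
  simp only [LinearMap.add_apply, LinearMap.smul_apply, LinearMap.comp_apply, LinearMap.id_apply]
  rw [h2, show (lowering S).toLinearMap (monomialOf I) = lowering S (monomialOf I) from rfl, h1,
    swapEigenvalue]
  module

theorem swapSum_eq_smul {S : Finset (Fin n)} {j : ℕ} {f : MvPolynomial (Fin n) ℂ}
    (hf : f ∈ squareFree S j) (h0 : lowering S f = 0) :
    swapSum S f = swapEigenvalue S.card j • f := by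
  simp [swapSum_eq_raising_lowering hf, h0]

end Operators

/-! ### The vectors attached to paths -/

section Paths

variable {n : ℕ}

/-- The set of the first `l` indices. -/
def initial (n l : ℕ) : Finset (Fin n) := Finset.univ.filter fun i => (i : ℕ) < l

/-- The number of elements of `P` among the first `l` indices. If `P` is the set of entries of
the second row of a tableau, this is the length of the second row of its `l`-th diagram. -/
def depth (P : Finset (Fin n)) (l : ℕ) : ℕ := (P ∩ initial n l).card

/-- The ballot condition for the first `l` steps: at no step is the second row longer
than the first one. -/
def IsBallot (P : Finset (Fin n)) (l : ℕ) : Prop := ∀ l' ≤ l, 2 * depth P l' ≤ l'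

@[simp] theorem mem_initial {l : ℕ} {i : Fin n} : i ∈ initial n l ↔ (i : ℕ) < l := by
  simp [initial]

theorem card_initial {l : ℕ} (hl : l ≤ n) : (initial n l).card = l := by
  rw [initial, Fin.card_filter_val_lt, min_eq_right hl]

theorem initial_self : initial n n = Finset.univ := by ext; simp

theorem initial_mono {l l' : ℕ} (h : l ≤ l') : initial n l ⊆ initial n l' := fun i hi => by
  rw [mem_initial] at *; omega

theorem initial_succ (i : Fin n) : initial n (i + 1) = insert i (initial n i) := by
  ext a
  simp only [mem_initial, Finset.mem_insert, Fin.ext_iff]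
  omega

theorem self_notMem_initial (i : Fin n) : i ∉ initial n i := by simp

theorem depth_zero (P : Finset (Fin n)) : depth P 0 = 0 := by simp [depth, initial]

theorem depth_succ_of_mem {P : Finset (Fin n)} {i : Fin n} (h : i ∈ P) :
    depth P (i + 1) = depth P i + 1 := by
  rw [depth, initial_succ, Finset.inter_insert_of_mem h, Finset.card_insert_of_notMem (by simp),
    depth]

theorem depth_succ_of_notMem {P : Finset (Fin n)} {i : Fin n} (h : i ∉ P) :
    depth P (i + 1) = depth P i := by
  rw [depth, initial_succ, Finset.inter_insert_of_notMem h, depth]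

theorem depth_congr {P P' : Finset (Fin n)} {l : ℕ}
    (h : ∀ i : Fin n, (i : ℕ) < l → (i ∈ P ↔ i ∈ P')) : depth P l = depth P' l := by
  unfold depth
  congr 1
  ext i
  simp only [Finset.mem_inter, mem_initial]
  exact and_congr_left fun hi => h i hi

theorem isBallot_congr {P P' : Finset (Fin n)} {l : ℕ}
    (h : ∀ i : Fin n, (i : ℕ) < l → (i ∈ P ↔ i ∈ P')) : IsBallot P l ↔ IsBallot P' l :=
  forall₂_congr fun l' hl' => by rw [depth_congr fun i hi => h i (hi.trans_le hl')]

theorem IsBallot.mono {P : Finset (Fin n)} {l l' : ℕ} (h : IsBallot P l) (hl : l' ≤ l) :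
    IsBallot P l' := fun _ hk => h _ (hk.trans hl)

theorem IsBallot.succ {P : Finset (Fin n)} {l : ℕ} (h : IsBallot P l)
    (hl : 2 * depth P (l + 1) ≤ l + 1) : IsBallot P (l + 1) := fun l' hl' => by
  rcases Nat.le_succ_iff.mp hl' with h' | rfl
  · exact h l' h'
  · exact hl

/-- A path is determined by the lengths of the second rows of its diagrams. -/
theorem eq_of_depth_eq {P P' : Finset (Fin n)} (h : ∀ l ≤ n, depth P l = depth P' l) : P = P' := by
  ext i
  have h0 := h i i.2.le
  have h1 := h (i + 1) i.2
  by_cases hP : i ∈ P <;> by_cases hP' : i ∈ P' <;> simp only [hP, hP']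
  · rw [depth_succ_of_mem hP, depth_succ_of_notMem hP'] at h1
    omega
  · rw [depth_succ_of_notMem hP, depth_succ_of_mem hP'] at h1
    omega

/-- One step of the construction of the Gelfand–Tsetlin vectors: from a lowest weight vector `g` of
degree `k` in the variables of `S` to one of degree `k + 1` in the variables of `S ∪ {i}`. -/
noncomputable def pathStep (S : Finset (Fin n)) (k : ℕ) (i : Fin n)
    (g : MvPolynomial (Fin n) ℂ) : MvPolynomial (Fin n) ℂ :=
  raising S g - ((S.card : ℂ) - 2 * k) • (MvPolynomial.X i * g)

/-- The Gelfand–Tsetlin vector in the variables `x_i`, `i < l`, attached to the path whose steps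
to the second row are the elements of `P`. It is a lowest weight vector. -/
noncomputable def pathVector (P : Finset (Fin n)) (l : Fin (n + 1)) : MvPolynomial (Fin n) ℂ :=
  Fin.induction (motive := fun _ => MvPolynomial (Fin n) ℂ) 1
    (fun i g => if i ∈ P then pathStep (initial n i) (depth P i) i g else g) l

theorem pathVector_zero (P : Finset (Fin n)) : pathVector P 0 = 1 := by simp [pathVector]

theorem pathVector_succ_of_mem {P : Finset (Fin n)} {i : Fin n} (h : i ∈ P) :
    pathVector P i.succ = pathStep (initial n i) (depth P i) i (pathVector P i.castSucc) := by
  simp [pathVector, h]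

theorem pathVector_succ_of_notMem {P : Finset (Fin n)} {i : Fin n} (h : i ∉ P) :
    pathVector P i.succ = pathVector P i.castSucc := by
  simp [pathVector, h]

theorem pathVector_congr {P P' : Finset (Fin n)} {l : Fin (n + 1)}
    (h : ∀ i : Fin n, (i : ℕ) < l → (i ∈ P ↔ i ∈ P')) : pathVector P l = pathVector P' l := by
  induction l using Fin.induction with
  | zero => simp [pathVector_zero]
  | succ i ih =>
    simp only [Fin.val_succ, Fin.val_castSucc] at h ih
    have ih := ih fun a ha => h a (by omega)
    have hi := h i (by omega)
    have hd : depth P i = depth P' i := depth_congr fun a ha => h a (by omega)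
    by_cases hP : i ∈ P
    · rw [pathVector_succ_of_mem hP, pathVector_succ_of_mem (hi.mp hP), ih, hd]
    · rw [pathVector_succ_of_notMem hP, pathVector_succ_of_notMem (mt hi.mpr hP), ih]

/-! ### Adding one variable -/

section Step

variable {S : Finset (Fin n)} {i : Fin n} {k : ℕ} {g : MvPolynomial (Fin n) ℂ}

theorem X_mem_squareFree (i : Fin n) :
    (MvPolynomial.X i : MvPolynomial (Fin n) ℂ) ∈ squareFree {i} 1 :=
  Submodule.subset_span ⟨{i}, subset_rfl, by simp, by simp [monomialOf]⟩

theorem X_mul_mem_squareFree (hi : i ∉ S) (hg : g ∈ squareFree S k) :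
    MvPolynomial.X i * g ∈ squareFree (insert i S) (k + 1) := by
  have := mul_mem_squareFree (Finset.disjoint_singleton_left.mpr hi) (X_mem_squareFree i) hg
  rwa [add_comm, ← Finset.insert_eq] at this

theorem raising_insert_apply (hi : i ∉ S) (hg : g ∈ squareFree S k) :
    raising (insert i S) g = raising S g + MvPolynomial.X i * g := by
  rw [raising_insert hi, raising_apply {i},
    squaring_eq_zero (Finset.disjoint_singleton_left.mpr hi) hg]
  simp

theorem raising_insert_X_mul (hi : i ∉ S) (hg : g ∈ squareFree S k) :
    raising (insert i S) (MvPolynomial.X i * g) = MvPolynomial.X i * raising S g := by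
  rw [mul_comm, raising_mul, raising_insert_apply hi hg]
  simp
  ring

theorem raising_insert_pow_X_mul (hi : i ∉ S) (hg : g ∈ squareFree S k) (r : ℕ) :
    (raising (insert i S) ^ r) (MvPolynomial.X i * g) = MvPolynomial.X i * (raising S ^ r) g := by
  induction r with
  | zero => simp
  | succ r ih =>
    rw [pow_succ', Module.End.mul_apply, ih,
      raising_insert_X_mul hi (raising_pow_mem_squareFree subset_rfl r hg), pow_succ',
      Module.End.mul_apply]

theorem raising_insert_pow (hi : i ∉ S) (hg : g ∈ squareFree S k) (r : ℕ) :
    (raising (insert i S) ^ (r + 1)) g =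
      (raising S ^ (r + 1)) g + ((r : ℂ) + 1) • (MvPolynomial.X i * (raising S ^ r) g) := by
  induction r with
  | zero => simp [raising_insert_apply hi hg]
  | succ r ih =>
    have hr := raising_pow_mem_squareFree (subset_refl S) r hg
    have hr1 := raising_pow_mem_squareFree (subset_refl S) (r + 1) hg
    rw [pow_succ', Module.End.mul_apply, ih, map_add, map_smul, raising_insert_X_mul hi hr,
      raising_insert_apply hi hr1, ← Module.End.mul_apply, ← Module.End.mul_apply,
      ← pow_succ', ← pow_succ']
    push_cast
    module

theorem raising_insert_pow_pathStep (hi : i ∉ S) (hg : g ∈ squareFree S k) (r : ℕ) :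
    (raising (insert i S) ^ r) (pathStep S k i g) = (raising S ^ (r + 1)) g -
      ((S.card : ℂ) - 2 * k - r) • (MvPolynomial.X i * (raising S ^ r) g) := by
  rw [pathStep, map_sub, map_smul, raising_insert_pow_X_mul hi hg]
  cases r with
  | zero => simp
  | succ r =>
    rw [raising_insert_pow hi (raising_mem_squareFree subset_rfl hg), ← Module.End.mul_apply,
      ← Module.End.mul_apply, ← pow_succ, ← pow_succ]
    push_cast
    module

theorem pathStep_mem_squareFree (hi : i ∉ S) (hg : g ∈ squareFree S k) :
    pathStep S k i g ∈ squareFree (insert i S) (k + 1) :=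
  Submodule.sub_mem _
    (squareFree_mono (Finset.subset_insert i S) _ (raising_mem_squareFree subset_rfl hg))
    (Submodule.smul_mem _ _ (X_mul_mem_squareFree hi hg))

theorem lowering_insert_X_mul (hi : i ∉ S) (hg : g ∈ squareFree S k) :
    lowering (insert i S) (MvPolynomial.X i * g) = g + MvPolynomial.X i * lowering S g := by
  rw [Derivation.leibniz, lowering_insert hi,
    lowering_eq_zero (Finset.disjoint_singleton_left.mpr hi) hg]
  simp
  ring

theorem lowering_pathStep (hi : i ∉ S) (hg : g ∈ squareFree S k) (h0 : lowering S g = 0) :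
    lowering (insert i S) (pathStep S k i g) = 0 := by
  have h1 := lowering_raising_pow hg h0 0
  simp only [zero_add, pow_one, pow_zero, Module.End.one_apply, Nat.cast_zero, one_mul,
    sub_zero] at h1
  rw [pathStep, map_sub, Derivation.map_smul, lowering_insert_X_mul hi hg, h0,
    lowering_insert hi, h1,
    lowering_eq_zero (Finset.disjoint_singleton_left.mpr hi) (raising_mem_squareFree subset_rfl hg)]
  simp

theorem pathStep_ne_zero (hi : i ∉ S) (hg : g ∈ squareFree S k) (hne : g ≠ 0)
    (hk : 2 * k < S.card) : pathStep S k i g ≠ 0 := by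
  intro h
  have h1 := congrArg (lowering {i}) h
  have hd := Finset.disjoint_singleton_left.mpr hi
  rw [pathStep, map_sub, Derivation.map_smul, Derivation.leibniz, lowering_eq_zero hd hg,
    lowering_eq_zero hd (raising_mem_squareFree subset_rfl hg)] at h1
  simp only [map_zero, lowering_X, Finset.mem_singleton, if_true, zero_add, zero_sub,
    smul_eq_mul, mul_zero, mul_one, neg_eq_zero, smul_eq_zero, hne, or_false] at h1
  have h2 : (S.card : ℂ) = 2 * k := by linear_combination h1
  have : S.card = 2 * k := by exact_mod_cast h2
  omega

end Step

/-! ### Properties of the path vectors -/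

theorem pathVector_mem_squareFree (P : Finset (Fin n)) (l : Fin (n + 1)) :
    pathVector P l ∈ squareFree (initial n l) (depth P l) := by
  induction l using Fin.induction with
  | zero =>
    rw [pathVector_zero, Fin.val_zero, depth_zero]
    exact Submodule.subset_span ⟨∅, by simp, by simp, by simp [monomialOf]⟩
  | succ i ih =>
    rw [Fin.val_castSucc] at ih
    rw [Fin.val_succ]
    by_cases hP : i ∈ P
    · rw [pathVector_succ_of_mem hP, depth_succ_of_mem hP, initial_succ]
      exact pathStep_mem_squareFree (self_notMem_initial i) ih
    · rw [pathVector_succ_of_notMem hP, depth_succ_of_notMem hP]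
      exact squareFree_mono (initial_mono (Nat.le_succ _)) _ ih

theorem lowering_pathVector (P : Finset (Fin n)) (l : Fin (n + 1)) :
    lowering (initial n l) (pathVector P l) = 0 := by
  induction l using Fin.induction with
  | zero => simp [pathVector_zero]
  | succ i ih =>
    have hm := pathVector_mem_squareFree P i.castSucc
    rw [Fin.val_castSucc] at ih hm
    rw [Fin.val_succ, initial_succ]
    by_cases hP : i ∈ P
    · rw [pathVector_succ_of_mem hP]
      exact lowering_pathStep (self_notMem_initial i) hm ih
    · rw [pathVector_succ_of_notMem hP, lowering_insert (self_notMem_initial i), ih,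
        lowering_eq_zero (by simp) hm, add_zero]

theorem raising_pow_pathVector_eq_zero (P : Finset (Fin n)) (l : Fin (n + 1)) {r : ℕ}
    (hr : (l : ℕ) < r + 2 * depth P l) :
    (raising (initial n l) ^ r) (pathVector P l) = 0 := by
  induction l using Fin.induction generalizing r with
  | zero =>
    rw [Fin.val_zero, depth_zero] at hr
    obtain ⟨r, rfl⟩ : ∃ r', r = r' + 1 := ⟨r - 1, by omega⟩
    have : (raising (initial n 0)) (1 : MvPolynomial (Fin n) ℂ) = 0 := by
      simp [raising_apply, initial]
    simp [pathVector_zero, pow_succ, Module.End.mul_apply, this]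
  | succ i ih =>
    have hm := pathVector_mem_squareFree P i.castSucc
    rw [Fin.val_castSucc] at hm ih
    rw [Fin.val_succ] at hr
    rw [Fin.val_succ, initial_succ]
    by_cases hP : i ∈ P
    · rw [depth_succ_of_mem hP] at hr
      rw [pathVector_succ_of_mem hP, raising_insert_pow_pathStep (self_notMem_initial i) hm,
        ih (by omega), card_initial i.2.le]
      -- The only power not killed on the level below comes with the coefficient zero.
      rcases Nat.lt_or_ge (i : ℕ) (r + 2 * depth P i) with h | h
      · simp [ih h]
      · have : (i : ℂ) = r + 2 * depth P i := by
          exact_mod_cast (show (i : ℕ) = r + 2 * depth P i by omega)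
        simp [this]
    · rw [depth_succ_of_notMem hP] at hr
      cases r with
      | succ r =>
        rw [pathVector_succ_of_notMem hP, raising_insert_pow (self_notMem_initial i) hm,
          ih (by omega), ih (by omega)]
        simp
      | zero =>
        have := ih (r := 0) (by omega)
        rw [pathVector_succ_of_notMem hP]
        simpa using this

theorem pathVector_ne_zero {P : Finset (Fin n)} {l : Fin (n + 1)} (h : IsBallot P l) :
    pathVector P l ≠ 0 := by
  induction l using Fin.induction with
  | zero => simp [pathVector_zero]
  | succ i ih =>
    rw [Fin.val_succ] at h
    have hm := pathVector_mem_squareFree P i.castSucc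
    rw [Fin.val_castSucc] at hm ih
    have ih := ih (h.mono (Nat.le_succ _))
    by_cases hP : i ∈ P
    · have h1 := h _ le_rfl
      rw [depth_succ_of_mem hP] at h1
      rw [pathVector_succ_of_mem hP]
      exact pathStep_ne_zero (self_notMem_initial i) hm ih (by rw [card_initial i.2.le]; omega)
    · rwa [pathVector_succ_of_notMem hP]

/-- The path vectors are eigenvectors of the sums of transpositions of all initial segments. -/
theorem swapSum_pathVector (P : Finset (Fin n)) {l : ℕ} {l' : Fin (n + 1)} (h : l ≤ l') :
    swapSum (initial n l) (pathVector P l') = swapEigenvalue l (depth P l) • pathVector P l' := by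
  induction l' using Fin.induction with
  | zero =>
    obtain rfl : l = 0 := by simpa using h
    have := swapSum_eq_smul (pathVector_mem_squareFree P 0) (lowering_pathVector P 0)
    rwa [Fin.val_zero, card_initial (Nat.zero_le n)] at this
  | succ i ih =>
    rw [Fin.val_succ] at h
    rw [Fin.val_castSucc] at ih
    rcases Nat.le_succ_iff.mp h with h' | rfl
    · have ih := ih h'
      by_cases hP : i ∈ P
      · have h1 := swapSum_raising_pow (initial_mono h') 1 (pathVector P i.castSucc)
        rw [pow_one] at h1
        have hd : Disjoint (initial n l) {i} := by simpa using h'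
        rw [pathVector_succ_of_mem hP, pathStep, map_sub, map_smul, h1,
          mul_comm (MvPolynomial.X i), swapSum_mul hd (X_mem_squareFree i), ih, map_smul, smul_sub,
          smul_mul_assoc, smul_comm]
      · rwa [pathVector_succ_of_notMem hP]
    · have := swapSum_eq_smul (pathVector_mem_squareFree P i.succ) (lowering_pathVector P i.succ)
      rwa [Fin.val_succ, card_initial (show (i : ℕ) + 1 ≤ n from i.2)] at this

/-! ### The square-free polynomials are spanned by raised path vectors -/

/-- The index set of the spanning family on level `l`: triples `(P, r, J)` of a ballot sequence `P`,
the exponent `r` of the raising operator, at most the length of its string, and a set `J` of further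
variables. -/
def IsIndex (l : ℕ) (a : Finset (Fin n) × ℕ × Finset (Fin n)) : Prop :=
  IsBallot a.1 l ∧ a.2.1 + 2 * depth a.1 l ≤ l ∧ Disjoint (initial n l) a.2.2

/-- The spanning family on level `l`: the path vectors raised within the first `l` variables, times
monomials in the other variables. -/
noncomputable def levelVector (l : Fin (n + 1)) (a : Finset (Fin n) × ℕ × Finset (Fin n)) :
    MvPolynomial (Fin n) ℂ :=
  (raising (initial n l) ^ a.2.1) (pathVector a.1 l) * monomialOf a.2.2

/-- The branching step: passing from `l` to `l + 1` variables, each string of length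
`l - 2 k + 1`, multiplied by `1` and by the new variable, is spanned by two strings. -/
theorem levelVector_castSucc_mem_span (i : Fin n) {a : Finset (Fin n) × ℕ × Finset (Fin n)}
    (ha : IsIndex (i : ℕ) a) :
    levelVector i.castSucc a ∈
      Submodule.span ℂ (levelVector i.succ '' {b | IsIndex (i + 1) b}) := by
  obtain ⟨P, r, J⟩ := a
  obtain ⟨hB, hr, hJ⟩ := ha
  simp only at hB hr hJ
  set W := Submodule.span ℂ (levelVector i.succ '' {b | IsIndex ((i : ℕ) + 1) b}) with hW
  set g := pathVector P i.castSucc with hg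
  have hgm : g ∈ squareFree (initial n i) (depth P i) := pathVector_mem_squareFree P i.castSucc
  have hi := self_notMem_initial i
  have hc0 : ∀ b : Fin n, (b : ℕ) < i → (b ∈ P ↔ b ∈ P.erase i) := fun b hb => by
    simp [Fin.ext_iff, hb.ne]
  have hc1 : ∀ b : Fin n, (b : ℕ) < i → (b ∈ P ↔ b ∈ insert i P) := fun b hb => by
    simp [Fin.ext_iff, hb.ne]
  -- It suffices to treat monomials `x_{J'}` in the variables after `i`, with and without the
  -- factor `x_i`.
  suffices key : ∀ J' : Finset (Fin n), Disjoint (initial n (i + 1)) J' →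
      (∀ r, r + 2 * depth P i ≤ i →
        (MvPolynomial.X i * (raising (initial n i) ^ r) g) * monomialOf J' ∈ W) ∧
      (∀ r, r + 2 * depth P i ≤ i → (raising (initial n i) ^ r) g * monomialOf J' ∈ W) by
    by_cases hiJ : i ∈ J
    · have hd : Disjoint (initial n (i + 1)) (J.erase i) := by
        rw [initial_succ, Finset.disjoint_insert_left]
        exact ⟨by simp, Finset.disjoint_of_subset_right (Finset.erase_subset _ _) hJ⟩
      have := (key _ hd).1 r hr
      rw [mul_comm (MvPolynomial.X i), mul_assoc, ← monomialOf_insert (Finset.notMem_erase i J),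
        Finset.insert_erase hiJ] at this
      exact this
    · have hd : Disjoint (initial n (i + 1)) J := by
        rw [initial_succ, Finset.disjoint_insert_left]
        exact ⟨hiJ, hJ⟩
      exact (key _ hd).2 r hr
  intro J' hJ'
  set M := W.comap (LinearMap.mulRight ℂ (monomialOf J')) with hM
  have hstay : ∀ r, r + 2 * depth P i ≤ i + 1 → (raising (initial n (i + 1)) ^ r) g ∈ M := by
    intro r hr
    have hd : depth (P.erase i) (i + 1) = depth P i := by
      rw [depth_succ_of_notMem (by simp), depth_congr hc0]
    have hidx : IsIndex ((i : ℕ) + 1) (P.erase i, r, J') :=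
      ⟨((isBallot_congr hc0).mp hB).succ (by have := hB i le_rfl; omega),
        by simpa [hd] using hr, hJ'⟩
    refine Submodule.subset_span ⟨_, hidx, ?_⟩
    simp only [levelVector, Fin.val_succ, LinearMap.mulRight_apply]
    rw [pathVector_succ_of_notMem (by simp), hg, pathVector_congr (P := P) (P' := P.erase i) hc0]
  have hmove : ∀ r, r + 2 * (depth P i + 1) ≤ i + 1 →
      (raising (initial n (i + 1)) ^ r) (pathStep (initial n i) (depth P i) i g) ∈ M := by
    intro r hr
    have hd : depth (insert i P) (i + 1) = depth P i + 1 := by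
      rw [depth_succ_of_mem (by simp), depth_congr hc1]
    have hidx : IsIndex ((i : ℕ) + 1) (insert i P, r, J') :=
      ⟨((isBallot_congr hc1).mp hB).succ (by omega), by simpa [hd] using hr, hJ'⟩
    refine Submodule.subset_span ⟨_, hidx, ?_⟩
    simp only [levelVector, Fin.val_succ, LinearMap.mulRight_apply]
    rw [pathVector_succ_of_mem (by simp), hg, pathVector_congr (P := P) (P' := insert i P) hc1,
      depth_congr hc1]
  -- Both strings on level `i + 1` have the same terms, so that a combination isolates the term with
  -- the new variable. At the end of the string the other term vanishes.
  have hX : ∀ r, r + 2 * depth P i ≤ i → MvPolynomial.X i * (raising (initial n i) ^ r) g ∈ M := by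
    intro r hr
    have h1 := hstay (r + 1) (by omega)
    rw [initial_succ, raising_insert_pow hi hgm] at h1
    rcases Nat.lt_or_ge (r + 2 * depth P i) i with hlt | hge
    · have h2 := hmove r (by omega)
      rw [initial_succ, raising_insert_pow_pathStep hi hgm, card_initial i.2.le] at h2
      have h3 := M.sub_mem h1 h2
      have hne : ((i : ℂ) - 2 * depth P i + 1) ≠ 0 := by
        intro h
        have : (i : ℂ) + 1 = 2 * depth P i := by linear_combination h
        have : (i : ℕ) + 1 = 2 * depth P i := by exact_mod_cast this
        omega
      have h4 : ((i : ℂ) - 2 * depth P i + 1) •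
          (MvPolynomial.X i * (raising (initial n i) ^ r) g) ∈ M := by
        convert h3 using 1
        module
      exact (M.smul_mem_iff hne).mp h4
    · have h0 : (raising (initial n i) ^ (r + 1)) g = 0 :=
        raising_pow_pathVector_eq_zero P i.castSucc (by simp; omega)
      rw [h0, zero_add] at h1
      exact (M.smul_mem_iff (by exact_mod_cast Nat.succ_ne_zero r)).mp h1
  refine ⟨hX, fun r hr => ?_⟩
  change (raising (initial n i) ^ r) g ∈ M
  cases r with
  | zero => simpa using hstay 0 (by omega)
  | succ r =>
    have h1 := hstay (r + 1) (by omega)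
    rw [initial_succ, raising_insert_pow hi hgm] at h1
    exact (M.add_mem_iff_left (M.smul_mem _ (hX r (by omega)))).mp h1

theorem monomialOf_mem_span_levelVector (l : Fin (n + 1)) (I : Finset (Fin n)) :
    monomialOf I ∈ Submodule.span ℂ (levelVector l '' {a | IsIndex (l : ℕ) a}) := by
  induction l using Fin.induction with
  | zero =>
    refine Submodule.subset_span ⟨(∅, 0, I), ⟨fun l' hl' => ?_, ?_, ?_⟩, ?_⟩
    · simp [depth]
    · simp [depth]
    · simp [initial]
    · simp [levelVector, pathVector_zero]
  | succ i ih =>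
    refine Submodule.span_le.mpr ?_ ih
    rintro _ ⟨a, ha, rfl⟩
    exact levelVector_castSucc_mem_span i ha

theorem squareFree_le_span_levelVector (l : Fin (n + 1)) (S : Finset (Fin n)) (q : ℕ) :
    squareFree S q ≤ Submodule.span ℂ (levelVector l '' {a | IsIndex (l : ℕ) a}) := by
  rw [squareFree, Submodule.span_le]
  rintro _ ⟨I, -, -, rfl⟩
  exact monomialOf_mem_span_levelVector l I

/-- The total degree of a vector of the spanning family. -/
theorem levelVector_mem_squareFree {l : Fin (n + 1)} {a : Finset (Fin n) × ℕ × Finset (Fin n)}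
    (ha : IsIndex (l : ℕ) a) :
    levelVector l a ∈ squareFree Finset.univ (depth a.1 l + a.2.1 + a.2.2.card) :=
  squareFree_mono (Finset.subset_univ _) _ (mul_mem_squareFree ha.2.2
    (raising_pow_mem_squareFree subset_rfl _ (pathVector_mem_squareFree a.1 l))
    (monomialOf_mem_squareFree subset_rfl))

/-- An eigenvector of the sum of transpositions of the first `l` indices is a combination of those
vectors of the spanning family that have the right second row and the right degree. -/
theorem mem_span_levelVector_of_swapSum_eq {l : Fin (n + 1)} {m k : ℕ} (hk : 2 * k ≤ l)
    {f : MvPolynomial (Fin n) ℂ} (hf : f ∈ squareFree Finset.univ m)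
    (hT : swapSum (initial n l) f = swapEigenvalue l k • f) :
    f ∈ Submodule.span ℂ (levelVector l '' {a | IsIndex (l : ℕ) a ∧ depth a.1 l = k ∧
      depth a.1 l + a.2.1 + a.2.2.card = m}) := by
  have h1 := mem_span_of_eigenvector (swapSum (initial n l)) (levelVector l)
    (fun a => swapEigenvalue l (depth a.1 l)) {a | IsIndex (l : ℕ) a}
    (fun a ha => by
      rw [levelVector, swapSum_mul ha.2.2 (monomialOf_mem_squareFree subset_rfl),
        swapSum_raising_pow subset_rfl, swapSum_pathVector _ le_rfl, map_smul, smul_mul_assoc])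
    (squareFree_le_span_levelVector l _ _ hf) hT
  have h2 := mem_span_of_eigenvector (euler Finset.univ).toLinearMap (levelVector l)
    (fun a => ((depth a.1 l + a.2.1 + a.2.2.card : ℕ) : ℂ)) _
    (fun a ha => euler_eq_smul subset_rfl (levelVector_mem_squareFree ha.1))
    h1 (euler_eq_smul subset_rfl hf)
  refine Submodule.span_mono (Set.image_mono ?_) h2
  rintro a ⟨⟨ha, hd⟩, hm⟩
  exact ⟨ha, swapEigenvalue_injective (ha.1 l le_rfl) hk hd, by exact_mod_cast hm⟩

end Paths

/-! ### The sums of pseudo-monomials as path vectors -/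

section PseudoMonomials

variable {n : ℕ}

/-- The product of the differences `x_{a j} - x_{b j}`. -/
noncomputable def differenceProduct {k : ℕ} (a b : Fin k → Fin n) : MvPolynomial (Fin n) ℂ :=
  ∏ j, (MvPolynomial.X (a j) - MvPolynomial.X (b j))

/-- The raising operator multiplies a pseudo-monomial by the sum of the unused variables, because
`(x_a - x_b)(x_a + x_b)` has no square-free terms. -/
theorem raising_pseudoMonomial {k r : ℕ} {S : Finset (Fin n)} {a b : Fin k → Fin n}
    {s : Fin r → Fin n} (h : Function.Injective (Sum.elim a (Sum.elim b s)))
    (ha : ∀ j, a j ∈ S) (hb : ∀ j, b j ∈ S) (hs : ∀ j, s j ∈ S) :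
    raising S (differenceProduct a b * ∏ c, MvPolynomial.X (s c)) =
      ∑ c ∈ S \ Finset.univ.image (Sum.elim a (Sum.elim b s)),
        MvPolynomial.X c * (differenceProduct a b * ∏ c, MvPolynomial.X (s c)) := by
  have h1 : squaring S (differenceProduct a b) =
      (∑ j, (MvPolynomial.X (a j) + MvPolynomial.X (b j))) * differenceProduct a b := by
    refine derivation_prod_of_eigen _ _ _ _ fun j _ => ?_
    rw [map_sub, squaring_X, squaring_X, if_pos (ha j), if_pos (hb j)]
    ring
  have h2 : squaring S (∏ c, MvPolynomial.X (s c)) =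
      (∑ c, MvPolynomial.X (s c)) * ∏ c, MvPolynomial.X (s c) := by
    refine derivation_prod_of_eigen _ _ _ _ fun j _ => ?_
    rw [squaring_X, if_pos (hs j)]
    ring
  have hsub : Finset.univ.image (Sum.elim a (Sum.elim b s)) ⊆ S := by
    intro c hc
    obtain ⟨x, -, rfl⟩ := Finset.mem_image.mp hc
    rcases x with j | j | j
    · exact ha j
    · exact hb j
    · exact hs j
  have h3 : ∑ i ∈ S, (MvPolynomial.X i : MvPolynomial (Fin n) ℂ) =
      ∑ c ∈ S \ Finset.univ.image (Sum.elim a (Sum.elim b s)), MvPolynomial.X c +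
        ((∑ j, (MvPolynomial.X (a j) + MvPolynomial.X (b j))) + ∑ c, MvPolynomial.X (s c)) := by
    rw [← Finset.sum_sdiff hsub, Finset.sum_image fun x _ y _ hxy => h hxy]
    simp [Fintype.sum_sum_type, Finset.sum_add_distrib, add_assoc]
  rw [raising_apply, Derivation.leibniz, h1, h2, h3, ← Finset.sum_mul]
  simp only [smul_eq_mul]
  ring

theorem differenceProduct_mem_squareFree {k : ℕ} {S : Finset (Fin n)} {a b : Fin k → Fin n}
    (h : Function.Injective (Sum.elim a b)) (ha : ∀ j, a j ∈ S) (hb : ∀ j, b j ∈ S) :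
    differenceProduct a b ∈ squareFree S k := by
  classical
  suffices key : ∀ t : Finset (Fin k), ∏ j ∈ t, (MvPolynomial.X (a j) - MvPolynomial.X (b j)) ∈
      squareFree (t.image a ∪ t.image b) t.card by
    have := key Finset.univ
    rw [Finset.card_univ, Fintype.card_fin] at this
    refine squareFree_mono (Finset.union_subset ?_ ?_) _ this
    · exact Finset.image_subset_iff.mpr fun j _ => ha j
    · exact Finset.image_subset_iff.mpr fun j _ => hb j
  obtain ⟨hai, hbi, hab⟩ := Sum.elim_injective.mp h
  intro t
  induction t using Finset.induction_on with
  | empty => exact Submodule.subset_span ⟨∅, by simp, by simp, by simp [monomialOf]⟩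
  | insert j t hj ih =>
    have h1 : (MvPolynomial.X (a j) - MvPolynomial.X (b j) : MvPolynomial (Fin n) ℂ) ∈
        squareFree {a j, b j} 1 :=
      Submodule.sub_mem _ (squareFree_mono (by simp) _ (X_mem_squareFree (a j)))
        (squareFree_mono (by simp) _ (X_mem_squareFree (b j)))
    have hd : Disjoint {a j, b j} (t.image a ∪ t.image b) := by
      simp only [Finset.disjoint_insert_left, Finset.disjoint_singleton_left, Finset.mem_union,
        Finset.mem_image, not_or, not_exists, not_and]
      refine ⟨⟨fun i hi he => hj (hai he ▸ hi), fun i _ he => hab j i he.symm⟩,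
        fun i _ he => hab i j he, fun i hi he => hj (hbi he ▸ hi)⟩
    have h2 := mul_mem_squareFree hd h1 ih
    rw [Finset.prod_insert hj, Finset.card_insert_of_notMem hj, add_comm]
    refine squareFree_mono ?_ _ h2
    intro c
    simp only [Finset.mem_union, Finset.mem_insert, Finset.mem_singleton, Finset.mem_image]
    grind

theorem lowering_differenceProduct {k : ℕ} {S : Finset (Fin n)} {a b : Fin k → Fin n}
    (ha : ∀ j, a j ∈ S) (hb : ∀ j, b j ∈ S) : lowering S (differenceProduct a b) = 0 := by
  have : lowering S (differenceProduct a b) = (∑ _j : Fin k, 0) * differenceProduct a b := by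
    refine derivation_prod_of_eigen _ _ _ _ fun j _ => ?_
    rw [map_sub, lowering_X, lowering_X, if_pos (ha j), if_pos (hb j), sub_self, zero_mul]
  rw [this, Finset.sum_const_zero, zero_mul]

open scoped Classical in
theorem pseudoMonomialSum_eq {k : ℕ} (r : ℕ) (p : Fin k → Fin n) :
    pseudoMonomialSum r p = ∑ a : Fin k → Fin n, ∑ s : Fin r → Fin n,
      if (∀ j, a j < p j) ∧ Function.Injective (Sum.elim a (Sum.elim p s)) then
        differenceProduct a p * ∏ c, MvPolynomial.X (s c) else 0 := by
  rw [pseudoMonomialSum, Finset.sum_filter, Fintype.sum_prod_type]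
  rfl

theorem pseudoMonomialSum_succ {k : ℕ} (r : ℕ) (p : Fin k → Fin n) :
    pseudoMonomialSum (r + 1) p = raising Finset.univ (pseudoMonomialSum r p) := by
  classical
  rw [pseudoMonomialSum_eq, pseudoMonomialSum_eq, map_sum]
  refine Finset.sum_congr rfl fun a _ => ?_
  rw [map_sum, ← (Fin.consEquiv fun _ => Fin n).sum_comp, Fintype.sum_prod_type, Finset.sum_comm]
  refine Finset.sum_congr rfl fun s _ => ?_
  have hinj : ∀ c, Function.Injective
      (Sum.elim a (Sum.elim p (Fin.cons c s : Fin (r + 1) → Fin n))) ↔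
        Function.Injective (Sum.elim a (Sum.elim p s)) ∧
          c ∉ Finset.univ.image (Sum.elim a (Sum.elim p s)) := fun c => by
    simp only [Sum.elim_injective, Fin.cons_injective_iff, Finset.mem_image, Finset.mem_univ,
      true_and, Sum.exists, Sum.elim_inl, Sum.elim_inr, Sum.forall, Fin.forall_fin_succ,
      Fin.cons_zero, Fin.cons_succ, Set.mem_range, ne_eq, not_or, not_exists]
    constructor
    · rintro ⟨h1, ⟨h2, ⟨h3, h4⟩, h5⟩, h6⟩
      exact ⟨⟨h1, ⟨h2, h4, fun j => (h5 j).2⟩, fun j => ⟨(h6 j).1, (h6 j).2.2⟩⟩,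
        fun j => (h6 j).2.1, fun j => (h5 j).1, h3⟩
    · rintro ⟨⟨h1, ⟨h2, h4, h5⟩, h6⟩, h8, h9, h3⟩
      exact ⟨h1, ⟨h2, ⟨h3, h4⟩, fun j => ⟨h9 j, h5 j⟩⟩, fun j => ⟨(h6 j).1, h8 j, (h6 j).2⟩⟩
  simp only [Fin.consEquiv, Equiv.coe_fn_mk, hinj]
  by_cases h : (∀ j, a j < p j) ∧ Function.Injective (Sum.elim a (Sum.elim p s))
  · rw [if_pos h, raising_pseudoMonomial h.2 (by simp) (by simp) (by simp),
      ← Finset.sum_filter_add_sum_filter_not Finset.univ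
        (· ∈ Finset.univ.image (Sum.elim a (Sum.elim p s)))]
    rw [Finset.sum_eq_zero, zero_add]
    · refine Finset.sum_congr (by ext; simp) fun c hc => ?_
      rw [if_pos ⟨h.1, h.2, by simpa using hc⟩, Fin.prod_univ_succ]
      simp only [Fin.cons_zero, Fin.cons_succ]
      ring
    · intro c hc
      rw [if_neg]
      rintro ⟨-, -, h3⟩
      exact h3 (Finset.mem_filter.mp hc).2
  · rw [if_neg h, map_zero]
    refine Finset.sum_eq_zero fun c _ => if_neg fun hc => h ⟨hc.1, hc.2.1⟩

theorem pseudoMonomialSum_eq_raising_pow {k : ℕ} (r : ℕ) (p : Fin k → Fin n) :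
    pseudoMonomialSum r p = (raising Finset.univ ^ r) (pseudoMonomialSum 0 p) := by
  induction r with
  | zero => simp
  | succ r ih => rw [pseudoMonomialSum_succ, ih, pow_succ', Module.End.mul_apply]

open scoped Classical in
theorem pseudoMonomialSum_zero {k : ℕ} (p : Fin k → Fin n) :
    pseudoMonomialSum 0 p = ∑ a : Fin k → Fin n,
      if (∀ j, a j < p j) ∧ Function.Injective (Sum.elim a p) then
        differenceProduct a p else 0 := by
  rw [pseudoMonomialSum_eq]
  refine Finset.sum_congr rfl fun a _ => ?_
  have : ∀ s : Fin 0 → Fin n, Function.Injective (Sum.elim a (Sum.elim p s)) ↔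
      Function.Injective (Sum.elim a p) := fun s => by
    simp [Sum.elim_injective, Function.injective_of_subsingleton]
  simp [this]

theorem pseudoMonomialSum_zero_snoc {k : ℕ} (p : Fin k → Fin n) (i : Fin n) (hp : ∀ j, p j < i) :
    pseudoMonomialSum 0 (Fin.snoc p i : Fin (k + 1) → Fin n) =
      pathStep (initial n i) k i (pseudoMonomialSum 0 p) := by
  classical
  rw [pseudoMonomialSum_zero, pseudoMonomialSum_zero, pathStep, map_sum, Finset.mul_sum,
    Finset.smul_sum, ← Finset.sum_sub_distrib, ← (Fin.snocEquiv fun _ => Fin n).sum_comp,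
    Fintype.sum_prod_type, Finset.sum_comm]
  refine Finset.sum_congr rfl fun a _ => ?_
  have hcond : ∀ c, ((∀ j, (Fin.snoc a c : Fin (k + 1) → Fin n) j <
        (Fin.snoc p i : Fin (k + 1) → Fin n) j) ∧
      Function.Injective (Sum.elim (Fin.snoc a c : Fin (k + 1) → Fin n)
        (Fin.snoc p i : Fin (k + 1) → Fin n))) ↔
      ((∀ j, a j < p j) ∧ Function.Injective (Sum.elim a p)) ∧
        c ∈ initial n i \ Finset.univ.image (Sum.elim a p) := fun c => by
    simp only [Sum.elim_injective, Fin.snoc_injective_iff, Finset.mem_image, Finset.mem_univ,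
      true_and, Sum.exists, Sum.elim_inl, Sum.elim_inr, Fin.forall_fin_succ',
      Fin.snoc_last, Fin.snoc_castSucc, Set.mem_range, ne_eq, not_or, not_exists,
      Finset.mem_sdiff, mem_initial]
    constructor
    · rintro ⟨⟨h1, h2⟩, ⟨h4, h3⟩, ⟨h6, h5⟩, h7, h8, h9⟩
      exact ⟨⟨h1, h4, h6, fun j => (h7 j).1⟩, h2, h3, fun j h => h8 j h.symm⟩
    · rintro ⟨⟨h1, h4, h6, h7⟩, h2, h3, h8⟩
      exact ⟨⟨h1, h2⟩, ⟨h4, h3⟩, ⟨h6, fun j => (hp j).ne⟩,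
        fun j => ⟨h7 j, ((h1 j).trans (hp j)).ne⟩, fun j h => h8 j h.symm,
        (Fin.lt_def.mpr h2).ne⟩
  simp only [Fin.snocEquiv, Equiv.coe_fn_mk, hcond]
  by_cases h : (∀ j, a j < p j) ∧ Function.Injective (Sum.elim a p)
  · simp only [h, true_and, if_true, implies_true]
    have hE := raising_pseudoMonomial (r := 0) (S := initial n i) (a := a) (b := p)
      (s := Fin.elim0) (by
        have := h.2
        simp only [Sum.elim_injective] at this ⊢
        simpa [Function.injective_of_subsingleton] using this)
      (fun j => by simpa using (h.1 j).trans (hp j)) (fun j => by simpa using hp j)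
      (fun j => j.elim0)
    have himg : Finset.univ.image (Sum.elim a (Sum.elim p (Fin.elim0 : Fin 0 → Fin n))) =
        Finset.univ.image (Sum.elim a p) := by
      ext c; simp
    rw [himg] at hE
    simp only [Finset.univ_eq_empty, Finset.prod_empty, mul_one] at hE
    have hcard : (((initial n i) \ Finset.univ.image (Sum.elim a p)).card : ℂ) =
        (initial n i).card - 2 * k := by
      have hsub : Finset.univ.image (Sum.elim a p) ⊆ initial n i := by
        intro c hc
        obtain ⟨x, -, rfl⟩ := Finset.mem_image.mp hc
        rcases x with j | j
        · simpa using (h.1 j).trans (hp j)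
        · simpa using hp j
      rw [Finset.card_sdiff_of_subset hsub, Nat.cast_sub (Finset.card_le_card hsub),
        Finset.card_image_of_injective _ h.2]
      simp
      ring
    rw [hE, ← hcard, Nat.cast_smul_eq_nsmul, ← Finset.sum_const, ← Finset.sum_sub_distrib,
      Finset.sum_ite_mem, Finset.univ_inter]
    refine Finset.sum_congr rfl fun c _ => ?_
    rw [differenceProduct, Fin.prod_univ_castSucc]
    simp only [Fin.snoc_castSucc, Fin.snoc_last, differenceProduct]
    ring
  · simp only [h, false_and, if_false, Finset.sum_const_zero, map_zero, mul_zero, smul_zero,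
      sub_zero]

/-- The sum of pseudo-monomials of degree `k` is the path vector of the set of the `p j`: the sum
over the last index `i_k` performs the last step of the path that goes to the second row. -/
theorem pathVector_eq_pseudoMonomialSum (P : Finset (Fin n)) (l : Fin (n + 1)) {k : ℕ}
    (p : Fin k → Fin n) (hp : StrictMono p)
    (hP : ∀ i : Fin n, (i ∈ P ∧ (i : ℕ) < l) ↔ ∃ j, p j = i) :
    pathVector P l = pseudoMonomialSum 0 p := by
  induction l using Fin.induction generalizing k with
  | zero =>
    obtain rfl : k = 0 := by
      by_contra hk
      exact absurd ((hP (p ⟨0, by omega⟩)).mpr ⟨_, rfl⟩).2 (by simp)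
    rw [pathVector_zero, pseudoMonomialSum_zero, Fintype.sum_unique, if_pos]
    · simp [differenceProduct]
    · exact ⟨fun j => j.elim0, fun x => by rcases x with x | x <;> exact x.elim0⟩
  | succ i ih =>
    simp only [Fin.val_succ, Fin.val_castSucc] at hP ih
    by_cases hi : i ∈ P
    · obtain ⟨j, hj⟩ := (hP i).mp ⟨hi, Nat.lt_succ_self _⟩
      obtain ⟨k, rfl⟩ : ∃ k', k = k' + 1 := ⟨k - 1, by have := j.2; omega⟩
      have hlast : p (Fin.last k) = i := by
        refine le_antisymm ?_ (hj ▸ hp.monotone (Fin.le_last j))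
        have := ((hP (p (Fin.last k))).mpr ⟨_, rfl⟩).2
        exact Fin.le_def.mpr (by omega)
      have hlt : ∀ j, Fin.init p j < i := fun j => hlast ▸ hp (Fin.castSucc_lt_last j)
      have hP' : ∀ a : Fin n, (a ∈ P ∧ (a : ℕ) < i) ↔ ∃ j, Fin.init p j = a := fun a => by
        constructor
        · rintro ⟨ha, hai⟩
          obtain ⟨j, rfl⟩ := (hP a).mp ⟨ha, by omega⟩
          induction j using Fin.lastCases with
          | last => rw [hlast] at hai; omega
          | cast j => exact ⟨j, rfl⟩
        · rintro ⟨j, rfl⟩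
          exact ⟨((hP _).mpr ⟨j.castSucc, rfl⟩).1, hlt j⟩
      have hstrict : StrictMono (Fin.init p) :=
        fun x y hxy => hp (Fin.castSucc_lt_castSucc_iff.mpr hxy)
      have hd : depth P i = k := by
        have : P ∩ initial n i = Finset.univ.image (Fin.init p) := by
          ext a
          simp only [Finset.mem_inter, mem_initial, hP', Finset.mem_image, Finset.mem_univ,
            true_and]
        rw [depth, this, Finset.card_image_of_injective _ hstrict.injective, Finset.card_univ,
          Fintype.card_fin]
      rw [pathVector_succ_of_mem hi, ih (Fin.init p) hstrict hP', hd,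
        ← pseudoMonomialSum_zero_snoc _ _ hlt, ← hlast, Fin.snoc_init_self]
    · rw [pathVector_succ_of_notMem hi]
      refine ih p hp fun a => ?_
      rw [← hP]
      refine and_congr_right fun ha => ?_
      have : a ≠ i := fun h => hi (h ▸ ha)
      have : (a : ℕ) ≠ i := fun h => this (Fin.ext h)
      omega

/-- The path vectors lie in the span of the Specht polynomials of two-row diagrams. -/
theorem pathVector_mem_span_differenceProduct (P : Finset (Fin n)) (l : Fin (n + 1)) :
    pathVector P l ∈ Submodule.span ℂ {f | ∃ a b : Fin (depth P l) → Fin n,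
      Function.Injective (Sum.elim a b) ∧ (∀ j, (a j : ℕ) < l) ∧ (∀ j, (b j : ℕ) < l) ∧
        f = differenceProduct a b} := by
  classical
  set p := (P ∩ initial n l).orderEmbOfFin (k := depth P l) rfl with hp
  have hP : ∀ i : Fin n, (i ∈ P ∧ (i : ℕ) < l) ↔ ∃ j, p j = i := fun i => by
    rw [← mem_initial, ← Finset.mem_inter, ← Finset.mem_coe,
      ← Finset.range_orderEmbOfFin (P ∩ initial n l) (k := depth P l) rfl]
    rfl
  rw [pathVector_eq_pseudoMonomialSum P l p p.strictMono hP, pseudoMonomialSum_zero]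
  refine Submodule.sum_mem _ fun a _ => ?_
  split_ifs with h
  · have hlt : ∀ j, (p j : ℕ) < l := fun j => ((hP _).mpr ⟨j, rfl⟩).2
    exact Submodule.subset_span
      ⟨a, p, h.2, fun j => (Fin.lt_def.mp (h.1 j)).trans (hlt j), hlt, rfl⟩
  · exact Submodule.zero_mem _

end PseudoMonomials

/-! ### Specht polynomials of two-row diagrams -/

section Specht

theorem mem_twoRow {n k : ℕ} (hk : 2 * k ≤ n) (c : ℕ × ℕ) :
    c ∈ (twoRow n k hk).cells ↔ (c.1 = 0 ∧ c.2 < n - k) ∨ (c.1 = 1 ∧ c.2 < k) := by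
  rw [YoungDiagram.mem_cells, twoRow, YoungDiagram.mem_ofRowLens]
  obtain ⟨i, j⟩ := c
  rcases i with _ | _ | i
  · simp
  · simp
  · simp

theorem mem_twoRow_first {n k : ℕ} (hk : 2 * k ≤ n) (j : Fin k) :
    ((0, (j : ℕ)) : ℕ × ℕ) ∈ (twoRow n k hk).cells := by
  rw [mem_twoRow]
  have := j.2
  simp
  omega

theorem card_twoRow {n k : ℕ} (hk : 2 * k ≤ n) : (twoRow n k hk).cells.card = n := by
  have : (twoRow n k hk).cells =
      ({0} ×ˢ Finset.range (n - k)) ∪ ({1} ×ˢ Finset.range k) := by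
    ext c
    rw [mem_twoRow]
    simp only [Finset.mem_union, Finset.mem_product, Finset.mem_singleton, Finset.mem_range]
  rw [this, Finset.card_union_of_disjoint]
  · simp
    omega
  · rw [Finset.disjoint_left]
    rintro c h1 h2
    simp only [Finset.mem_product, Finset.mem_singleton] at h1 h2
    omega

/-- The columns of length two of a two-row diagram are indexed by `Fin k`. -/
theorem spechtPolynomial_twoRow {n k : ℕ} {hk : 2 * k ≤ n} (t : (twoRow n k hk).cells ≃ Fin n) :
    spechtPolynomial t = differenceProduct (fun j : Fin k => t ⟨(0, j), mem_twoRow_first hk j⟩)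
      (fun j => t ⟨(1, j), mem_twoRow_second hk j⟩) := by
  rw [spechtPolynomial, ← Fintype.prod_prod_type', differenceProduct, eq_comm]
  refine Fintype.prod_of_injective
    (fun j : Fin k => ((⟨(0, j), mem_twoRow_first hk j⟩, ⟨(1, j), mem_twoRow_second hk j⟩) :
      (twoRow n k hk).cells × (twoRow n k hk).cells)) ?_ _ _ ?_ ?_
  · intro x y hxy
    simpa [Fin.ext_iff] using hxy
  · rintro ⟨⟨⟨c1, c2⟩, hc⟩, ⟨⟨d1, d2⟩, hd⟩⟩ h
    refine if_neg ?_
    rintro ⟨h1, h2⟩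
    simp only at h1 h2
    subst h1
    have hc' := (mem_twoRow hk _).mp hc
    have hd' := (mem_twoRow hk _).mp hd
    simp only at hc' hd'
    obtain ⟨rfl, rfl, h3⟩ : c1 = 0 ∧ d1 = 1 ∧ c2 < k := by omega
    exact h ⟨⟨c2, h3⟩, rfl⟩
  · intro j
    simp

theorem exists_spechtPolynomial_eq {n k : ℕ} (hk : 2 * k ≤ n) {a b : Fin k → Fin n}
    (h : Function.Injective (Sum.elim a b)) :
    ∃ t : (twoRow n k hk).cells ≃ Fin n, spechtPolynomial t = differenceProduct a b := by
  classical
  let t₀ : (twoRow n k hk).cells ≃ Fin n :=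
    Fintype.equivFinOfCardEq (by rw [Fintype.card_coe, card_twoRow])
  let e : Fin k ⊕ Fin k → Fin n := Sum.elim
    (fun j => t₀ ⟨(0, j), mem_twoRow_first hk j⟩) (fun j => t₀ ⟨(1, j), mem_twoRow_second hk j⟩)
  have he : Function.Injective e := by
    refine Sum.elim_injective.mpr ⟨fun x y hxy => ?_, fun x y hxy => ?_, fun x y hxy => ?_⟩
    · simpa [Fin.ext_iff] using hxy
    · simpa [Fin.ext_iff] using hxy
    · simp at hxy
  -- A permutation that carries the two-cell columns of `t₀` to the prescribed pairs.
  let ε : {x // x ∈ Set.range e} ≃ {x // x ∈ Set.range (Sum.elim a b)} :=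
    (Equiv.ofInjective e he).symm.trans (Equiv.ofInjective _ h)
  have hε : ∀ x, ε.extendSubtype (e x) = Sum.elim a b x := fun x => by
    rw [Equiv.extendSubtype_apply_of_mem _ _ ⟨x, rfl⟩]
    simp only [ε, Equiv.trans_apply]
    have : (Equiv.ofInjective e he).symm ⟨e x, ⟨x, rfl⟩⟩ = x :=
      Equiv.ofInjective_symm_apply he x
    rw [this]
    rfl
  refine ⟨t₀.trans ε.extendSubtype, ?_⟩
  rw [spechtPolynomial_twoRow]
  congr 1
  · ext1 j
    exact hε (Sum.inl j)
  · ext1 j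
    exact hε (Sum.inr j)

/-- The Specht module of a two-row diagram is spanned by products of differences. -/
theorem spechtModule_twoRow {n k : ℕ} (hk : 2 * k ≤ n) :
    (spechtModule n (twoRow n k hk)).toSubmodule = Submodule.span ℂ
      {f | ∃ a b : Fin k → Fin n,
        Function.Injective (Sum.elim a b) ∧ f = differenceProduct a b} := by
  refine congrArg (Submodule.span ℂ) (Set.ext fun f => ?_)
  constructor
  · rintro ⟨t, rfl⟩
    refine ⟨_, _, ?_, spechtPolynomial_twoRow t⟩
    refine Sum.elim_injective.mpr ⟨fun x y hxy => ?_, fun x y hxy => ?_, fun x y hxy => ?_⟩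
    · simpa [Fin.ext_iff] using hxy
    · simpa [Fin.ext_iff] using hxy
    · simp at hxy
  · rintro ⟨a, b, h, rfl⟩
    exact exists_spechtPolynomial_eq hk h

theorem rename_differenceProduct {n l k : ℕ} (g : Fin l → Fin n) (a b : Fin k → Fin l) :
    MvPolynomial.rename g (differenceProduct a b) = differenceProduct (g ∘ a) (g ∘ b) := by
  simp [differenceProduct]

/-- Elements of a two-row Specht module for `𝔖_l` are lowest weight vectors in the first `l` of
any number of variables. -/
theorem rename_mem_of_mem_spechtModule {n l k : ℕ} (hl : l ≤ n) (hk : 2 * k ≤ l)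
    {w : MvPolynomial (Fin l) ℂ} (hw : w ∈ (spechtModule l (twoRow l k hk)).toSubmodule) :
    MvPolynomial.rename (Fin.castLE hl) w ∈ squareFree (initial n l) k ∧
      lowering (initial n l) (MvPolynomial.rename (Fin.castLE hl) w) = 0 := by
  rw [spechtModule_twoRow] at hw
  have hle : Submodule.span ℂ {f | ∃ a b : Fin k → Fin l, Function.Injective (Sum.elim a b) ∧
      f = differenceProduct a b} ≤ (squareFree (initial n l) k ⊓
        LinearMap.ker (lowering (initial n l)).toLinearMap).comap
          (MvPolynomial.rename (Fin.castLE hl)).toLinearMap := by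
    rw [Submodule.span_le]
    rintro _ ⟨a, b, h, rfl⟩
    have ha : ∀ j, (Fin.castLE hl ∘ a) j ∈ initial n l := fun j => by simp
    have hb : ∀ j, (Fin.castLE hl ∘ b) j ∈ initial n l := fun j => by simp
    have hab : Function.Injective (Sum.elim (Fin.castLE hl ∘ a) (Fin.castLE hl ∘ b)) := by
      rw [← Sum.comp_elim]
      exact (Fin.castLE_injective hl).comp h
    simp only [SetLike.mem_coe, Submodule.mem_comap, AlgHom.toLinearMap_apply,
      rename_differenceProduct]
    exact ⟨differenceProduct_mem_squareFree hab ha hb, lowering_differenceProduct ha hb⟩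
  exact hle hw

/-! ### Isotypic components as eigenspaces -/

/-- The sum of all transpositions of `𝔖_l` (over ordered pairs, with the identity for equal
indices) in the group algebra. -/
noncomputable def swapElement (l : ℕ) : MonoidAlgebra ℂ (Equiv.Perm (Fin l)) :=
  ∑ i, ∑ j, MonoidAlgebra.single (Equiv.swap i j) 1

theorem asAlgebraHom_swapElement {l : ℕ} {V : Type*} [AddCommGroup V] [Module ℂ V]
    (ρ : Representation ℂ (Equiv.Perm (Fin l)) V) (v : V) :
    ρ.asAlgebraHom (swapElement l) v = ∑ i, ∑ j, ρ (Equiv.swap i j) v := by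
  simp [swapElement, Representation.asAlgebraHom_single]

theorem viaEmbedding_swap {l n : ℕ} (hl : l ≤ n) (i j : Fin l) :
    Equiv.Perm.viaEmbedding (Equiv.swap i j) (Fin.castLEEmb hl) =
      Equiv.swap (Fin.castLE hl i) (Fin.castLE hl j) := by
  ext a
  congr 1
  by_cases ha : a ∈ Set.range (Fin.castLEEmb hl)
  · obtain ⟨b, rfl⟩ := ha
    rw [Equiv.Perm.viaEmbedding_apply]
    exact ((Fin.castLE_injective hl).swap_apply i j b).symm
  · rw [Equiv.Perm.viaEmbedding_apply_of_notMem _ _ _ ha, Equiv.swap_apply_of_ne_of_ne]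
    · rintro rfl; exact ha ⟨i, rfl⟩
    · rintro rfl; exact ha ⟨j, rfl⟩

theorem restrictedRep_apply_coe {n m l : ℕ} (hl : l ≤ n) (g : Equiv.Perm (Fin l))
    (f : Forms n m) : (restrictedRep n m l hl g f : MvPolynomial (Fin n) ℂ) =
      polyRep n (Equiv.Perm.viaEmbedding g (Fin.castLEEmb hl)) f := rfl

theorem spechtRep_apply_coe {l : ℕ} {μ : YoungDiagram} (g : Equiv.Perm (Fin l))
    (w : (spechtModule l μ).toSubmodule) :
    (spechtRep l μ g w : MvPolynomial (Fin l) ℂ) = polyRep l g w := rfl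

theorem coe_restrictedRep_swapElement {n m l : ℕ} (hl : l ≤ n) (f : Forms n m) :
    ((restrictedRep n m l hl).asAlgebraHom (swapElement l) f : MvPolynomial (Fin n) ℂ) =
      swapSum (initial n l) f := by
  have h : initial n l = Finset.univ.map (Fin.castLEEmb hl) := by
    ext a
    simp only [mem_initial, Finset.mem_map, Finset.mem_univ, true_and, Fin.castLEEmb_apply]
    exact ⟨fun ha => ⟨⟨a, ha⟩, rfl⟩, by rintro ⟨b, rfl⟩; exact b.2⟩
  rw [asAlgebraHom_swapElement, swapSum_apply, h]
  simp [restrictedRep_apply_coe, viaEmbedding_swap]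

theorem spechtRep_swapElement {l k : ℕ} (hk : 2 * k ≤ l)
    (w : (spechtModule l (twoRow l k hk)).toSubmodule) :
    (spechtRep l (twoRow l k hk)).asAlgebraHom (swapElement l) w = swapEigenvalue l k • w := by
  apply Subtype.ext
  have h := rename_mem_of_mem_spechtModule le_rfl hk w.2
  rw [show Fin.castLE (le_refl l) = id from rfl, MvPolynomial.rename_id_apply] at h
  have h2 := swapSum_eq_smul h.1 h.2
  rw [card_initial le_rfl, initial_self, swapSum_apply] at h2
  rw [asAlgebraHom_swapElement]
  simpa [spechtRep_apply_coe] using h2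

/-- Raising a Specht polynomial within the first `l` variables and multiplying it by a monomial
in the other variables gives an element of the isotypic component. -/
theorem levelVector_mem_isotypicSubspace {n m : ℕ} {l : Fin (n + 1)}
    {a : Finset (Fin n) × ℕ × Finset (Fin n)} (ha : IsIndex (l : ℕ) a) (hl : (l : ℕ) ≤ n)
    {k : ℕ} (hk : 2 * k ≤ l) (hd : depth a.1 l = k) (hm : depth a.1 l + a.2.1 + a.2.2.card = m) :
    levelVector l a ∈ (isotypicSubspace (restrictedRep n m l hl)
      (spechtRep l (twoRow l k hk))).map (Forms n m).subtype := by
  subst hd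
  have hsp := fun w : (spechtModule l (twoRow l (depth a.1 l) hk)).toSubmodule =>
    rename_mem_of_mem_spechtModule hl hk w.2
  let φ₀ : (spechtModule l (twoRow l (depth a.1 l) hk)).toSubmodule →ₗ[ℂ] MvPolynomial (Fin n) ℂ :=
    LinearMap.mulRight ℂ (monomialOf a.2.2) ∘ₗ (raising (initial n l) ^ a.2.1) ∘ₗ
      (MvPolynomial.rename (Fin.castLE hl)).toLinearMap ∘ₗ Submodule.subtype _
  have hφ₀ : ∀ w, φ₀ w = (raising (initial n l) ^ a.2.1)
      (MvPolynomial.rename (Fin.castLE hl) (w : MvPolynomial (Fin l) ℂ)) * monomialOf a.2.2 :=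
    fun _ => rfl
  have hmem : ∀ w, φ₀ w ∈ Forms n m := fun w => by
    rw [forms_eq_squareFree, hφ₀, ← hm]
    exact squareFree_mono (Finset.subset_univ _) _ (mul_mem_squareFree ha.2.2
      (raising_pow_mem_squareFree subset_rfl _ (hsp w).1) (monomialOf_mem_squareFree subset_rfl))
  let φ := φ₀.codRestrict (Forms n m) hmem
  have hinj : Function.Injective φ := by
    rw [injective_iff_map_eq_zero]
    intro w hw
    have hw0 : φ₀ w = 0 := congrArg Subtype.val hw
    rw [hφ₀] at hw0
    by_contra hne
    have hne' : MvPolynomial.rename (Fin.castLE hl) (w : MvPolynomial (Fin l) ℂ) ≠ 0 := by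
      intro h
      refine hne (Subtype.ext (MvPolynomial.rename_injective _ (Fin.castLE_injective hl) ?_))
      simpa using h
    rcases mul_eq_zero.mp hw0 with h | h
    · refine raising_pow_ne_zero (hsp w).1 (hsp w).2 hne' ?_ h
      rw [card_initial hl]
      exact ha.2.1
    · exact (Finset.prod_ne_zero_iff.mpr fun i _ => MvPolynomial.X_ne_zero i) h
  have hequiv : ∀ g w, φ (spechtRep l _ g w) = restrictedRep n m l hl g (φ w) := by
    intro g w
    apply Subtype.ext
    rw [restrictedRep_apply_coe]
    change φ₀ _ = polyRep n _ (φ₀ w)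
    set τ := Equiv.Perm.viaEmbedding g (Fin.castLEEmb hl) with hτ
    have hτ1 : ∀ b : Fin l, τ (Fin.castLE hl b) = Fin.castLE hl (g b) := fun b =>
      Equiv.Perm.viaEmbedding_apply g (Fin.castLEEmb hl) b
    have hτ2 : ∀ b ∈ a.2.2, τ b = b := fun b hb => by
      refine Equiv.Perm.viaEmbedding_apply_of_notMem _ _ _ ?_
      rintro ⟨c, rfl⟩
      exact Finset.disjoint_left.mp ha.2.2 (by simp) hb
    have hτS : (initial n l).map τ.toEmbedding = initial n l := by
      refine Finset.eq_of_subset_of_card_le (fun b hb => ?_) (by simp)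
      obtain ⟨c, hc, rfl⟩ := Finset.mem_map.mp hb
      have : c = Fin.castLE hl ⟨c, mem_initial.mp hc⟩ := rfl
      rw [this, Equiv.coe_toEmbedding, hτ1]
      simp
    have h1 : MvPolynomial.rename (Fin.castLE hl) (spechtRep l _ g w : MvPolynomial (Fin l) ℂ) =
        polyRep n τ (MvPolynomial.rename (Fin.castLE hl) (w : MvPolynomial (Fin l) ℂ)) := by
      rw [spechtRep_apply_coe, polyRep_apply, polyRep_apply, MvPolynomial.rename_rename,
        MvPolynomial.rename_rename]
      congr 2
      ext1 b
      exact (hτ1 b).symm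
    have h2 := polyRep_eq_self τ hτ2 (monomialOf_mem_squareFree (subset_refl a.2.2))
    rw [hφ₀, hφ₀, h1, ← polyRep_raising_pow τ hτS]
    conv_lhs => rw [← h2]
    rw [polyRep_apply, polyRep_apply, polyRep_apply, map_mul]
  have hpath : ∃ w : (spechtModule l (twoRow l (depth a.1 l) hk)).toSubmodule,
      MvPolynomial.rename (Fin.castLE hl) (w : MvPolynomial (Fin l) ℂ) = pathVector a.1 l := by
    have h1 := pathVector_mem_span_differenceProduct a.1 l
    have h2 : pathVector a.1 l ∈ (spechtModule l (twoRow l (depth a.1 l) hk)).toSubmodule.map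
        (MvPolynomial.rename (Fin.castLE hl)).toLinearMap := by
      refine Submodule.span_le.mpr ?_ h1
      rintro _ ⟨b, c, hbc, hb, hc, rfl⟩
      refine ⟨differenceProduct (fun j => ⟨b j, hb j⟩) (fun j => ⟨c j, hc j⟩), ?_, ?_⟩
      · rw [spechtModule_twoRow]
        refine Submodule.subset_span ⟨_, _, ?_, rfl⟩
        refine Function.Injective.of_comp (f := Fin.castLE hl) ?_
        rw [Sum.comp_elim]
        exact hbc
      · rw [AlgHom.toLinearMap_apply, rename_differenceProduct]
        rfl
    obtain ⟨w, hw, hw2⟩ := h2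
    exact ⟨⟨w, hw⟩, hw2⟩
  obtain ⟨w, hw⟩ := hpath
  refine ⟨φ w, apply_mem_isotypicSubspace φ hinj hequiv w, ?_⟩
  change φ₀ w = _
  rw [hφ₀, hw, levelVector]

/-- The isotypic component of type `π_{(l-k,k)}` with respect to `𝔖_l` is an eigenspace of the sum
of the transpositions of the first `l` indices. -/
theorem mem_isotypicSubspace_restrictedRep_iff {n m l k : ℕ} (hl : l ≤ n) (hk : 2 * k ≤ l)
    (f : Forms n m) :
    f ∈ isotypicSubspace (restrictedRep n m l hl) (spechtRep l (twoRow l k hk)) ↔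
      swapSum (initial n l) f = swapEigenvalue l k • (f : MvPolynomial (Fin n) ℂ) := by
  constructor
  · intro hf
    rw [← coe_restrictedRep_swapElement hl, asAlgebraHom_apply_of_mem_isotypicSubspace _ _
      (spechtRep_swapElement hk) hf, Submodule.coe_smul]
  · intro hf
    have h1 := mem_span_levelVector_of_swapSum_eq (l := ⟨l, Nat.lt_succ_of_le hl⟩) (m := m) hk
      (by rw [← forms_eq_squareFree]; exact f.2) hf
    have h2 : (f : MvPolynomial (Fin n) ℂ) ∈ (isotypicSubspace (restrictedRep n m l hl)
        (spechtRep l (twoRow l k hk))).map (Forms n m).subtype := by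
      refine Submodule.span_le.mpr ?_ h1
      rintro _ ⟨a, ⟨ha, hd, hm⟩, rfl⟩
      exact levelVector_mem_isotypicSubspace (l := ⟨l, Nat.lt_succ_of_le hl⟩) ha hl hk hd hm
    obtain ⟨f', hf', hff⟩ := h2
    rwa [← show f' = f from Subtype.ext hff]

theorem restrictedRep_self (n m : ℕ) : restrictedRep n m n le_rfl = formRep n m := by
  ext g f : 2
  have : Equiv.Perm.viaEmbedding g (Fin.castLEEmb (le_refl n)) = g := by
    ext1 a
    exact Equiv.Perm.viaEmbedding_apply g (Fin.castLEEmb (le_refl n)) a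
  apply Subtype.ext
  rw [restrictedRep_apply_coe, this]
  rfl

theorem mem_hSubspace_iff {n m k : ℕ} (hk : 2 * k ≤ n) (f : Forms n m) :
    f ∈ hSubspace n m k hk ↔
      swapSum (initial n n) f = swapEigenvalue n k • (f : MvPolynomial (Fin n) ℂ) := by
  rw [hSubspace, ← restrictedRep_self, mem_isotypicSubspace_restrictedRep_iff]

end Specht

/-! ### Tableaux and ballot sequences -/

section Tableaux

variable {n k : ℕ} {hk : 2 * k ≤ n}

namespace Tableau

/-- The set of the entries of the second row. -/
def rowSet (u : Tableau (twoRow n k hk) n) : Finset (Fin n) := Finset.univ.image u.secondRow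

theorem secondRow_strictMono (u : Tableau (twoRow n k hk) n) : StrictMono u.secondRow := by
  refine Monotone.strictMono_of_injective (fun i j hij => u.monotone_entry ?_) fun i j hij => ?_
  · exact Prod.mk_le_mk.mpr ⟨le_rfl, hij⟩
  · simpa [secondRow, Fin.ext_iff] using hij

theorem mem_diagram (u : Tableau (twoRow n k hk) n) (l : ℕ) (c : ℕ × ℕ) :
    c ∈ u.diagram l ↔ ∃ h : c ∈ (twoRow n k hk).cells, (u.entry ⟨c, h⟩ : ℕ) < l := by
  rw [← YoungDiagram.mem_cells, diagram]
  simp only [Finset.mem_map, Finset.mem_filter, Finset.mem_univ, true_and,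
    Function.Embedding.subtype_apply]
  constructor
  · rintro ⟨d, hd, rfl⟩
    exact ⟨d.2, hd⟩
  · rintro ⟨h, hc⟩
    exact ⟨⟨c, h⟩, hc, rfl⟩

theorem card_diagram (u : Tableau (twoRow n k hk) n) {l : ℕ} (hl : l ≤ n) :
    (u.diagram l).cells.card = l := by
  rw [diagram, Finset.card_map]
  refine Eq.trans (Finset.card_bij (t := initial n l) (fun c _ => u.entry c) ?_ ?_ ?_)
    (card_initial hl)
  · intro c hc
    simpa using hc
  · intro c _ d _ h
    exact u.entry.injective h
  · intro i hi
    exact ⟨u.entry.symm i, by simpa using hi, by simp⟩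

theorem rowLen_diagram (u : Tableau (twoRow n k hk) n) (l : ℕ) :
    (u.diagram l).rowLen 1 = depth u.rowSet l := by
  have h1 : (u.diagram l).row 1 = (Finset.univ.filter fun j : Fin k =>
      (u.secondRow j : ℕ) < l).image fun j : Fin k => ((1, (j : ℕ)) : ℕ × ℕ) := by
    ext c
    simp only [YoungDiagram.mem_row_iff, mem_diagram, Finset.mem_image, Finset.mem_filter,
      Finset.mem_univ, true_and]
    constructor
    · rintro ⟨⟨h, hc⟩, h1⟩
      obtain ⟨c1, c2⟩ := c
      simp only at h1
      subst h1
      have := (mem_twoRow hk _).mp h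
      simp only at this
      exact ⟨⟨c2, by omega⟩, hc, rfl⟩
    · rintro ⟨j, hj, rfl⟩
      exact ⟨⟨mem_twoRow_second hk j, hj⟩, rfl⟩
  have h2 : u.rowSet ∩ initial n l = (Finset.univ.filter fun j : Fin k =>
      (u.secondRow j : ℕ) < l).image u.secondRow := by
    ext i
    simp only [rowSet, Finset.mem_inter, Finset.mem_image, Finset.mem_univ, true_and, mem_initial,
      Finset.mem_filter]
    constructor
    · rintro ⟨⟨j, rfl⟩, hj⟩
      exact ⟨j, hj, rfl⟩
    · rintro ⟨j, hj, rfl⟩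
      exact ⟨⟨j, rfl⟩, hj⟩
  rw [YoungDiagram.rowLen_eq_card, h1, depth, h2,
    Finset.card_image_of_injective _ u.secondRow_strictMono.injective,
    Finset.card_image_of_injective _ fun x y hxy => by simpa [Fin.ext_iff] using hxy]

theorem rowLen_add_rowLen (u : Tableau (twoRow n k hk) n) {l : ℕ} (hl : l ≤ n) :
    (u.diagram l).rowLen 0 + (u.diagram l).rowLen 1 = l := by
  conv_rhs => rw [← u.card_diagram hl]
  rw [← Finset.card_filter_add_card_filter_not (s := (u.diagram l).cells) fun c => c.1 = 0,
    YoungDiagram.rowLen_eq_card, YoungDiagram.rowLen_eq_card]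
  congr 1
  congr 1
  ext c
  rw [YoungDiagram.mem_row_iff, Finset.mem_filter, YoungDiagram.mem_cells]
  refine and_congr_right fun hc => ?_
  obtain ⟨h, -⟩ := (u.mem_diagram l c).mp hc
  have := (mem_twoRow hk c).mp h
  omega

theorem isBallot_rowSet (u : Tableau (twoRow n k hk) n) : IsBallot u.rowSet n := fun l hl => by
  have h1 := u.rowLen_add_rowLen hl
  have h2 := (u.diagram l).rowLen_anti 0 1 zero_le_one
  rw [← u.rowLen_diagram]
  omega

theorem diagram_eq_twoRow (u : Tableau (twoRow n k hk) n) {l : ℕ} (hl : l ≤ n) :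
    u.diagram l = twoRow l (depth u.rowSet l) (u.isBallot_rowSet l hl) := by
  have h1 := u.rowLen_add_rowLen hl
  have h2 := u.rowLen_diagram l
  refine YoungDiagram.ext (Finset.ext fun c => ?_)
  rw [mem_twoRow, YoungDiagram.mem_cells]
  obtain ⟨i, j⟩ := c
  by_cases hc : (i, j) ∈ (twoRow n k hk).cells
  · rw [YoungDiagram.mem_iff_lt_rowLen]
    rcases (mem_twoRow hk _).mp hc with ⟨h, -⟩ | ⟨h, -⟩ <;> simp only at h <;> subst h
    · simp
      omega
    · simp
      omega
  · have : (i, j) ∉ u.diagram l := fun h => hc ((u.mem_diagram l _).mp h).1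
    have h0 := YoungDiagram.mem_iff_lt_rowLen.not.mp this
    simp only [this, false_iff]
    rintro (⟨rfl, h⟩ | ⟨rfl, h⟩) <;> omega

theorem depth_rowSet_self (u : Tableau (twoRow n k hk) n) : depth u.rowSet n = k := by
  rw [depth, initial_self, Finset.inter_univ, rowSet,
    Finset.card_image_of_injective _ u.secondRow_strictMono.injective]
  simp

theorem rowSet_injective :
    Function.Injective (rowSet : Tableau (twoRow n k hk) n → Finset (Fin n)) := by
  intro u u' h
  have hd : ∀ l ≤ n, u.diagram l = u'.diagram l := fun l hl => by
    rw [u.diagram_eq_twoRow hl, u'.diagram_eq_twoRow hl]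
    simp only [h]
  have hlt : ∀ c, ∀ l ≤ n, (u.entry c : ℕ) < l ↔ (u'.entry c : ℕ) < l := fun c l hl => by
    have h1 := u.mem_diagram l c
    rw [hd l hl, u'.mem_diagram l c] at h1
    simpa using h1.symm
  have he : u.entry = u'.entry := by
    ext c
    have h1 := (hlt c _ (u.entry c).2).mp (Nat.lt_succ_self _)
    have h2 := (hlt c _ (u'.entry c).2).mpr (Nat.lt_succ_self _)
    omega
  cases u
  cases u'
  congr

end Tableau

theorem depth_mono (P : Finset (Fin n)) {l l' : ℕ} (h : l ≤ l') : depth P l ≤ depth P l' :=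
  Finset.card_le_card (Finset.inter_subset_inter_left (initial_mono h))

/-- The first row of the diagrams of a path does not decrease either. -/
theorem depth_le_depth_add (P : Finset (Fin n)) {l l' : ℕ} (h : l ≤ l') (hl' : l' ≤ n) :
    depth P l' ≤ depth P l + (l' - l) := by
  induction l', h using Nat.le_induction with
  | base => simp
  | succ l' h ih =>
    have ih := ih (by omega)
    by_cases hP : (⟨l', hl'⟩ : Fin n) ∈ P
    · have := depth_succ_of_mem hP
      simp only at this
      omega
    · have := depth_succ_of_notMem hP
      simp only at this
      omega

/-- The cell of the tableau attached to a path that is filled in step `i`. -/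
def pathCell (P : Finset (Fin n)) (i : Fin n) : ℕ × ℕ :=
  if i ∈ P then (1, depth P i) else (0, i - depth P i)

theorem pathCell_mem {P : Finset (Fin n)} (hB : IsBallot P n) (hP : depth P n = k) (i : Fin n) :
    pathCell P i ∈ (twoRow n k hk).cells := by
  have h1 := depth_mono P (show (i : ℕ) + 1 ≤ n from i.2)
  have h2 := depth_le_depth_add P (show (i : ℕ) + 1 ≤ n from i.2) le_rfl
  have h3 := hB i i.2.le
  rw [mem_twoRow, pathCell]
  by_cases hi : i ∈ P
  · rw [depth_succ_of_mem hi] at h1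
    rw [if_pos hi]
    right
    simp
    omega
  · rw [depth_succ_of_notMem hi] at h2
    rw [if_neg hi]
    left
    simp
    omega

/-- A later cell of a ballot sequence is never weakly above and to the left of an earlier one. -/
theorem not_pathCell_le {P : Finset (Fin n)} (hB : IsBallot P n) {i i' : Fin n} (h : i' < i) :
    ¬ pathCell P i ≤ pathCell P i' := by
  have h' : (i' : ℕ) + 1 ≤ i := h
  have h1 := depth_mono P h'
  have h2 := depth_le_depth_add P h' i.2.le
  have h3 := hB i i.2.le
  have h4 := hB i' i'.2.le
  unfold pathCell
  by_cases hi : i ∈ P <;> by_cases hi' : i' ∈ P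
  · rw [depth_succ_of_mem hi'] at h1
    simp [hi, hi']
    omega
  · simp [hi, hi']
  · rw [depth_succ_of_mem hi'] at h1
    simp [hi, hi']
    omega
  · rw [depth_succ_of_notMem hi'] at h2
    simp [hi, hi']
    omega

/-- Every ballot sequence comes from a tableau. -/
theorem exists_tableau {P : Finset (Fin n)} (hB : IsBallot P n) (hP : depth P n = k) :
    ∃ u : Tableau (twoRow n k hk) n, u.rowSet = P := by
  let cell : Fin n → (twoRow n k hk).cells := fun i => ⟨pathCell P i, pathCell_mem hB hP i⟩
  have hinj : Function.Injective cell := by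
    intro i i' h
    have h' : pathCell P i = pathCell P i' := congrArg Subtype.val h
    rcases lt_trichotomy i i' with hlt | heq | hlt
    · exact absurd h'.ge (not_pathCell_le hB hlt)
    · exact heq
    · exact absurd h'.le (not_pathCell_le hB hlt)
  have hbij : Function.Bijective cell :=
    (Fintype.bijective_iff_injective_and_card cell).mpr
      ⟨hinj, by rw [Fintype.card_fin, Fintype.card_coe, card_twoRow]⟩
  let e := Equiv.ofBijective cell hbij
  have he : ∀ c, pathCell P (e.symm c) = c := fun c => congrArg Subtype.val (e.apply_symm_apply c)
  refine ⟨⟨e.symm, fun c d hcd => ?_⟩, ?_⟩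
  · by_contra hlt
    refine not_pathCell_le hB (not_le.mp hlt) ?_
    rw [he, he]
    exact hcd
  · ext i
    simp only [Tableau.rowSet, Finset.mem_image, Finset.mem_univ, true_and, Tableau.secondRow]
    constructor
    · rintro ⟨j, rfl⟩
      by_contra hj
      have := he ⟨(1, (j : ℕ)), mem_twoRow_second hk j⟩
      rw [pathCell, if_neg hj] at this
      simp at this
    · intro hi
      have h1 : pathCell P i = (1, depth P i) := if_pos hi
      have h2 := pathCell_mem (hk := hk) hB hP i
      rw [h1, mem_twoRow] at h2
      refine ⟨⟨depth P i, by simpa using h2⟩, ?_⟩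
      rw [Equiv.symm_apply_eq]
      exact Subtype.ext h1.symm

end Tableaux

/-! ### The Gelfand–Tsetlin vectors -/

section GelfandTsetlin

variable {n m k : ℕ} {hk : 2 * k ≤ n}

theorem pseudoMonomialSum_secondRow (r : ℕ) (u : Tableau (twoRow n k hk) n) :
    pseudoMonomialSum r u.secondRow = levelVector (Fin.last n) (u.rowSet, r, ∅) := by
  rw [pseudoMonomialSum_eq_raising_pow, levelVector, Fin.val_last, initial_self,
    pathVector_eq_pseudoMonomialSum u.rowSet (Fin.last n) u.secondRow u.secondRow_strictMono]
  · simp [monomialOf]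
  · simp [Tableau.rowSet]

theorem isIndex_rowSet (hkm : k ≤ m) (hmn : k + m ≤ n) (u : Tableau (twoRow n k hk) n) :
    IsIndex n (u.rowSet, m - k, (∅ : Finset (Fin n))) :=
  ⟨u.isBallot_rowSet, by simp only [u.depth_rowSet_self]; omega, by simp⟩

theorem pseudoMonomialSum_mem_forms (hkm : k ≤ m) (hmn : k + m ≤ n)
    (u : Tableau (twoRow n k hk) n) : pseudoMonomialSum (m - k) u.secondRow ∈ Forms n m := by
  rw [pseudoMonomialSum_secondRow, forms_eq_squareFree]
  have := levelVector_mem_squareFree (l := Fin.last n) (isIndex_rowSet hkm hmn u)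
  simpa [u.depth_rowSet_self, hkm] using this

theorem pseudoMonomialSum_ne_zero (hkm : k ≤ m) (hmn : k + m ≤ n)
    (u : Tableau (twoRow n k hk) n) : pseudoMonomialSum (m - k) u.secondRow ≠ 0 := by
  rw [pseudoMonomialSum_secondRow, levelVector]
  refine mul_ne_zero ?_ (by simp [monomialOf])
  refine raising_pow_ne_zero (pathVector_mem_squareFree _ _) (lowering_pathVector _ _)
    (pathVector_ne_zero u.isBallot_rowSet) ?_
  rw [card_initial (Nat.le_of_lt_succ (Fin.last n).2)]
  exact (isIndex_rowSet hkm hmn u).2.1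

theorem swapSum_levelVector_last {a : Finset (Fin n) × ℕ × Finset (Fin n)} (ha : IsIndex n a)
    {l : ℕ} (hl : l ≤ n) : swapSum (initial n l) (levelVector (Fin.last n) a) =
      swapEigenvalue l (depth a.1 l) • levelVector (Fin.last n) a := by
  have hd : Disjoint (initial n l) a.2.2 :=
    Finset.disjoint_of_subset_left (initial_mono hl) ha.2.2
  rw [levelVector, swapSum_mul hd (monomialOf_mem_squareFree subset_rfl), Fin.val_last,
    swapSum_raising_pow (initial_mono hl), swapSum_pathVector _ (by simpa using hl), map_smul,
    smul_mul_assoc]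

theorem swapSum_pseudoMonomialSum (hkm : k ≤ m) (hmn : k + m ≤ n)
    (u : Tableau (twoRow n k hk) n) {l : ℕ} (hl : l ≤ n) :
    swapSum (initial n l) (pseudoMonomialSum (m - k) u.secondRow) =
      swapEigenvalue l (depth u.rowSet l) • pseudoMonomialSum (m - k) u.secondRow := by
  rw [pseudoMonomialSum_secondRow]
  exact swapSum_levelVector_last (isIndex_rowSet hkm hmn u) hl

theorem mem_gzSubspace_iff (u : Tableau (twoRow n k hk) n) (f : Forms n m) :
    f ∈ gzSubspace m u ↔ ∀ l ≤ n, swapSum (initial n l) f =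
      swapEigenvalue l (depth u.rowSet l) • (f : MvPolynomial (Fin n) ℂ) := by
  rw [gzSubspace, Submodule.mem_inf, Submodule.mem_iInf, mem_hSubspace_iff]
  have h : ∀ l : Fin n, f ∈ isotypicSubspace (restrictedRep n m l l.is_lt.le)
      (spechtRep l (u.diagram l)) ↔ swapSum (initial n l) f =
        swapEigenvalue l (depth u.rowSet l) • (f : MvPolynomial (Fin n) ℂ) := fun l => by
    rw [u.diagram_eq_twoRow l.is_lt.le, mem_isotypicSubspace_restrictedRep_iff]
  simp only [h]
  constructor
  · rintro ⟨h1, h2⟩ l hl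
    rcases hl.lt_or_eq with hlt | rfl
    · exact h2 ⟨l, hlt⟩
    · rwa [u.depth_rowSet_self]
  · intro h1
    refine ⟨?_, fun l => h1 l l.is_lt.le⟩
    have := h1 n le_rfl
    rwa [u.depth_rowSet_self] at this

/-- On the last level the spanning family of `H_{n,m}^k` consists of the sums of
pseudo-monomials. -/
theorem exists_tableau_of_isIndex (hkm : k ≤ m) {a : Finset (Fin n) × ℕ × Finset (Fin n)}
    (ha : IsIndex n a) (hd : depth a.1 n = k) (hm : depth a.1 n + a.2.1 + a.2.2.card = m) :
    ∃ u : Tableau (twoRow n k hk) n, a = (u.rowSet, m - k, ∅) := by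
  obtain ⟨P, r, J⟩ := a
  obtain ⟨hB, -, hJ⟩ := ha
  simp only at hB hd hm hJ
  obtain rfl : J = ∅ := by
    rw [initial_self] at hJ
    exact Finset.eq_empty_of_forall_notMem fun i =>
      Finset.disjoint_left.mp hJ (Finset.mem_univ i)
  obtain ⟨u, rfl⟩ := exists_tableau (hk := hk) hB hd
  refine ⟨u, ?_⟩
  have : r = m - k := by
    rw [Finset.card_empty] at hm
    omega
  rw [this]

theorem mem_span_pseudoMonomialSum (hkm : k ≤ m) {f : Forms n m} (hf : f ∈ hSubspace n m k hk) :
    (f : MvPolynomial (Fin n) ℂ) ∈ Submodule.span ℂ (Set.range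
      fun u : Tableau (twoRow n k hk) n => pseudoMonomialSum (m - k) u.secondRow) := by
  have hfm : (f : MvPolynomial (Fin n) ℂ) ∈ squareFree Finset.univ m := by
    rw [← forms_eq_squareFree]; exact f.2
  have h := mem_span_levelVector_of_swapSum_eq (l := Fin.last n) hk hfm
    ((mem_hSubspace_iff hk f).mp hf)
  refine Submodule.span_mono ?_ h
  rintro _ ⟨a, ⟨ha, hd, hm⟩, rfl⟩
  obtain ⟨u, rfl⟩ := exists_tableau_of_isIndex (hk := hk) hkm ha hd hm
  exact ⟨u, pseudoMonomialSum_secondRow _ u⟩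

/-- A combination of the sums of pseudo-monomials over a set of tableaux that is a joint eigenvector
with the eigenvalues of the tableau `u` is a multiple of the sum attached to `u`. -/
theorem mem_span_image_of_swapSum_eq (hkm : k ≤ m) (hmn : k + m ≤ n)
    (u : Tableau (twoRow n k hk) n) (s : Set (Tableau (twoRow n k hk) n))
    {f : MvPolynomial (Fin n) ℂ}
    (hf : f ∈ Submodule.span ℂ ((fun u : Tableau (twoRow n k hk) n =>
      pseudoMonomialSum (m - k) u.secondRow) '' s))
    (hT : ∀ l ≤ n, swapSum (initial n l) f = swapEigenvalue l (depth u.rowSet l) • f) :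
    f ∈ Submodule.span ℂ ((fun u : Tableau (twoRow n k hk) n =>
      pseudoMonomialSum (m - k) u.secondRow) '' (s ∩ {u})) := by
  have h := mem_span_of_joint_eigenvector (fun l : ℕ => swapSum (initial n l))
    (fun u : Tableau (twoRow n k hk) n => pseudoMonomialSum (m - k) u.secondRow)
    (fun v l => swapEigenvalue l (depth v.rowSet l)) (Finset.range (n + 1)) s
      (c := fun l => swapEigenvalue l (depth u.rowSet l))
    (fun v _ l hl => swapSum_pseudoMonomialSum hkm hmn v
      (Nat.lt_succ_iff.mp (Finset.mem_range.mp hl)))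
    hf (fun l hl => hT l (Nat.lt_succ_iff.mp (Finset.mem_range.mp hl)))
  refine Submodule.span_mono (Set.image_mono ?_) h
  rintro v ⟨hv, hχ⟩
  refine ⟨hv, Tableau.rowSet_injective (eq_of_depth_eq fun l hl => ?_)⟩
  exact swapEigenvalue_injective (v.isBallot_rowSet l hl) (u.isBallot_rowSet l hl)
    (hχ l (Finset.mem_range.mpr (Nat.lt_succ_of_le hl)))

theorem map_gzSubspace (hkm : k ≤ m) (hmn : k + m ≤ n) (u : Tableau (twoRow n k hk) n) :
    (gzSubspace m u).map (Forms n m).subtype =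
      Submodule.span ℂ {pseudoMonomialSum (m - k) u.secondRow} := by
  apply le_antisymm
  · rintro _ ⟨f, hf, rfl⟩
    have h1 := mem_span_pseudoMonomialSum hkm hf.1
    rw [← Set.image_univ] at h1
    have h2 := mem_span_image_of_swapSum_eq hkm hmn u _ h1 ((mem_gzSubspace_iff u f).mp hf)
    simpa using h2
  · rw [Submodule.span_singleton_le_iff_mem]
    exact ⟨⟨_, pseudoMonomialSum_mem_forms hkm hmn u⟩, (mem_gzSubspace_iff u _).mpr
      fun l hl => swapSum_pseudoMonomialSum hkm hmn u hl, rfl⟩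

theorem linearIndependent_pseudoMonomialSum (hkm : k ≤ m) (hmn : k + m ≤ n) :
    LinearIndependent ℂ fun u : Tableau (twoRow n k hk) n =>
      pseudoMonomialSum (m - k) u.secondRow := by
  rw [linearIndependent_iff_notMem_span]
  intro u hu
  have h := mem_span_image_of_swapSum_eq hkm hmn u _ hu
    fun l hl => swapSum_pseudoMonomialSum hkm hmn u hl
  have hempty : (Set.univ \ {u}) ∩ {u} = (∅ : Set (Tableau (twoRow n k hk) n)) := by simp
  rw [hempty, Set.image_empty, Submodule.span_empty, Submodule.mem_bot] at h
  exact pseudoMonomialSum_ne_zero hkm hmn u h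

theorem formNorm_smul (m : ℕ) (c : ℂ) (f : MvPolynomial (Fin n) ℂ) :
    formNorm m (c • f) = ‖c‖ * formNorm m f := by
  simp only [formNorm, MvPolynomial.coeff_smul, norm_smul, mul_pow, ← Finset.mul_sum]
  rw [Real.sqrt_mul (sq_nonneg _), Real.sqrt_sq (norm_nonneg c)]

theorem isGelfandTsetlinBasis_iff (hkm : k ≤ m) (hmn : k + m ≤ n)
    (h : Tableau (twoRow n k hk) n → Forms n m) :
    IsGelfandTsetlinBasis n m k hk h ↔ ∀ u, ∃ c : ℂ,
      ‖c‖ * formNorm m (pseudoMonomialSum (m - k) u.secondRow) = 1 ∧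
        (h u : MvPolynomial (Fin n) ℂ) = c • pseudoMonomialSum (m - k) u.secondRow := by
  constructor
  · intro H u
    have h1 : (h u : MvPolynomial (Fin n) ℂ) ∈ (gzSubspace m u).map (Forms n m).subtype :=
      ⟨h u, H.mem u, rfl⟩
    rw [map_gzSubspace hkm hmn, Submodule.mem_span_singleton] at h1
    obtain ⟨c, hc⟩ := h1
    refine ⟨c, ?_, hc.symm⟩
    rw [← formNorm_smul, hc]
    exact H.norm_eq_one u
  · intro H
    choose c hc hh using H
    have hc0 : ∀ u, c u ≠ 0 := fun u h0 => by
      have := hc u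
      simp [h0] at this
    have hmem : ∀ u, h u ∈ gzSubspace m u := fun u => by
      rw [mem_gzSubspace_iff]
      intro l hl
      rw [hh, map_smul, swapSum_pseudoMonomialSum hkm hmn u hl, smul_comm]
    refine ⟨hmem, fun u => by rw [hh, formNorm_smul, hc], ?_, ?_⟩
    · refine LinearIndependent.of_comp (Forms n m).subtype ?_
      have h1 := (linearIndependent_pseudoMonomialSum (hk := hk) hkm hmn).units_smul
        fun u => Units.mk0 (c u) (hc0 u)
      convert h1 using 1
      ext1 u
      exact hh u
    · apply le_antisymm
      · rw [Submodule.span_le]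
        rintro _ ⟨u, rfl⟩
        exact (hmem u).1
      · intro f hf
        have h1 := mem_span_pseudoMonomialSum hkm hf
        have h2 : (f : MvPolynomial (Fin n) ℂ) ∈
            (Submodule.span ℂ (Set.range h)).map (Forms n m).subtype := by
          refine Submodule.span_le.mpr ?_ h1
          rintro _ ⟨u, rfl⟩
          refine ⟨(c u)⁻¹ • h u, Submodule.smul_mem _ _ (Submodule.subset_span ⟨u, rfl⟩), ?_⟩
          rw [map_smul, Submodule.subtype_apply, hh, inv_smul_smul₀ (hc0 u)]
        obtain ⟨f', hf', hff⟩ := h2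
        rwa [← show f' = f from Subtype.ext hff]

end GelfandTsetlin

end TwoRowTensor

theorem mainTheorem4 (n m k : ℕ) (hk : 2 * k ≤ n) (hkm : k ≤ m) (hmn : k + m ≤ n) :
    (∀ u : TwoRowTensor.Tableau (TwoRowTensor.twoRow n k hk) n,
      TwoRowTensor.pseudoMonomialSum (m - k) u.secondRow ≠ 0 ∧
      (TwoRowTensor.gzSubspace m u).map (TwoRowTensor.Forms n m).subtype =
        Submodule.span ℂ {TwoRowTensor.pseudoMonomialSum (m - k) u.secondRow}) ∧
    (∀ h : TwoRowTensor.Tableau (TwoRowTensor.twoRow n k hk) n → TwoRowTensor.Forms n m,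
      TwoRowTensor.IsGelfandTsetlinBasis n m k hk h ↔
        ∀ u, ∃ c : ℂ,
          ‖c‖ * TwoRowTensor.formNorm m
            (TwoRowTensor.pseudoMonomialSum (m - k) u.secondRow) = 1 ∧
          (h u : MvPolynomial (Fin n) ℂ) =
            c • TwoRowTensor.pseudoMonomialSum (m - k) u.secondRow) :=
  ⟨fun u => ⟨TwoRowTensor.pseudoMonomialSum_ne_zero hkm hmn u,
    TwoRowTensor.map_gzSubspace hkm hmn u⟩,
    fun h => TwoRowTensor.isGelfandTsetlinBasis_iff hkm hmn h⟩
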